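/- Let $W_2=\mathrm{Tot}(\mathcal O_{\mathbb P^1}(-2)\oplus\mathcal O_{\mathbb P^1})$, that is, the complex threefold obtained from two charts $U=\mathbb C^3=\{(z,u_1,u_2)\}$ and $V=\mathbb C^3=\{(\xi,v_1,v_2)\}$ glued over $U\cap V=(\mathbb C\setminus\{0\})\times\mathbb C^2$ by $(\xi,v_1,v_2)=(z^{-1},z^2u_1,u_2)$. Let $H^1(W_2,\mathrm{End}(TW_2))$ be the first cohomology of the sheaf of holomorphic endomorphisms of the tangent bundle, computed by the Čech complex of the covering $\{U,V\}$: it is $\Gamma(U\cap V,\mathrm{End}(TW_2))$ modulo $\{\,b|_{U\cap V}-a|_{U\cap V} : a\in\Gamma(U,\mathrm{End}(TW_2)),\ b\in\Gamma(V,\mathrm{End}(TW_2))\,\}$. Then $W_2$ has infinite-dimensional moduli of holomorphic bundles, in the following sense. 1. The Zariski tangent space at $TW_2$ of the moduli of holomorphic bundles on $W_2$, i.e. the set of isomorphism classes of first-order deformations of $TW_2$ (obtained by gluing $TW_2[\varepsilon]|_U$ and $TW_2[\varepsilon]|_V$, $\varepsilon^2=0$, by an automorphism $1+\varepsilon\sigma$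 over $U\cap V$; isomorphisms are the identity modulo $\varepsilon$), is in bijection with $H^1(W_2,\mathrm{End}(TW_2))$ by sending the deformation glued by $1+\varepsilon\sigma$ to the class of $\sigma$. 2. The complex vector space $H^1(W_2,\mathrm{End}(TW_2))$ is infinite-dimensional. 3. For every $n\ge 0$ there is a holomorphic family $(E_t)_{t\in\mathbb C^n}$ of vector bundles on $W_2$ with $E_0=TW_2$ (where $E_t$ is glued from $TW_2|_U$ and $TW_2|_V$ by an automorphism $\theta_t$ of $TW_2|_{U\cap V}$ that is jointly holomorphic in $t$ and the point, with $\theta_0=1$) whose Kodaira–Spencer map $\mathbb C^n\to H^1(W_2,\mathrm{End}(TW_2))$, $v\mapsto[\partial_v\theta_t|_{t=0}]$, is injective. 4. Write endomorphisms of $TW_2$ over $U\cap V$ as $3\times3$ matrices in the frame $\partial_z,\partial_{u_1},\partial_{u_2}$ acting on column vectors, and let $E_{rs}$ be the matrix whose only nonzero entry is a $1$ in row $r$ and column $s$. Then $H^1(W_2,\mathrm{End}(TW_2))$ is generated by the holomorphic cocycles $$z^{-1}u_1u_2^k\,E_{21},\qquad z^{-i}u_2^k\,E_{21}\ (i=1,2,3),\qquad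 z^{-1}u_2^k\,E_{23},\qquad z^{-1}u_2^k\,E_{31}\qquad(k\ge 0),$$ in the sense that every class is represented by a cocycle that is the sum of a series of complex multiples of them, unconditionally convergent at every point of $U\cap V$. -/

import Mathlib

open scoped Manifold ContDiff Topology
open Bundle

noncomputable section

namespace LocalCY

/-! ### The threefold `W₂ = Tot(𝒪(-2) ⊕ 𝒪)` over the projective line -/

/-- The coordinate space `ℂ³`, with coordinates numbered `0, 1, 2`: `(z, u₁, u₂)` on the chart `U`
and `(ξ, v₁, v₂)` on the chart `V`. -/
abbrev C3 : Type := Fin 3 → ℂ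

/-- The change of coordinates `(z, u₁, u₂) ↦ (ξ, v₁, v₂) = (z⁻¹, z² u₁, u₂)`, meaningful where
`z ≠ 0`. It is an involution, so that the inverse change of coordinates has the same formula. -/
def tau (x : C3) : C3 := ![(x 0)⁻¹, (x 0) ^ 2 * x 1, x 2]

@[simp] lemma tau_zero (x : C3) : tau x 0 = (x 0)⁻¹ := rfl
@[simp] lemma tau_one (x : C3) : tau x 1 = (x 0) ^ 2 * x 1 := rfl
@[simp] lemma tau_two (x : C3) : tau x 2 = x 2 := rfl

lemma tau_tau {x : C3} (hx : x 0 ≠ 0) : tau (tau x) = x := by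
  funext i
  fin_cases i <;> (simp [tau]; try field_simp)

/-- The gluing relation on the disjoint union of the two copies of `ℂ³`. -/
def glue : C3 ⊕ C3 → C3 ⊕ C3 → Prop
  | Sum.inl x, Sum.inl y => x = y
  | Sum.inr x, Sum.inr y => x = y
  | Sum.inl x, Sum.inr y => x 0 ≠ 0 ∧ y = tau x
  | Sum.inr x, Sum.inl y => x 0 ≠ 0 ∧ y = tau x

lemma glue_symm {a b : C3 ⊕ C3} (h : glue a b) : glue b a := by
  rcases a with x | x <;> rcases b with y | y
  · exact Eq.symm h
  · obtain ⟨h0, rfl⟩ := h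
    exact ⟨by simpa using h0, (tau_tau h0).symm⟩
  · obtain ⟨h0, rfl⟩ := h
    exact ⟨by simpa using h0, (tau_tau h0).symm⟩
  · exact Eq.symm h

lemma glue_trans {a b c : C3 ⊕ C3} (h : glue a b) (h' : glue b c) : glue a c := by
  rcases a with x | x <;> rcases b with y | y <;> rcases c with w | w
  · exact Eq.trans h h'
  · obtain rfl : x = y := h
    exact h'
  · obtain ⟨h0, rfl⟩ := h
    obtain ⟨-, rfl⟩ := h'
    exact (tau_tau h0).symm
  · obtain rfl : y = w := h'
    exact h
  · obtain rfl : y = w := h'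
    exact h
  · obtain ⟨h0, rfl⟩ := h
    obtain ⟨-, rfl⟩ := h'
    exact (tau_tau h0).symm
  · obtain rfl : x = y := h
    exact h'
  · exact Eq.trans h h'

/-- The gluing relation as an equivalence relation. -/
def glueSetoid : Setoid (C3 ⊕ C3) where
  r := glue
  iseqv :=
    { refl := fun a => by cases a <;> rfl
      symm := glue_symm
      trans := glue_trans }

/-- The threefold `W₂`: two copies of `ℂ³`, glued by
`(ξ, v₁, v₂) = (z⁻¹, z² u₁, u₂)` over `(ℂ ∖ {0}) × ℂ²`. -/
def W2 : Type := Quotient glueSetoid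

/-- The point of `W₂` with coordinates `(z, u₁, u₂)` in the chart `U`. -/
def ptU (x : C3) : W2 := Quotient.mk glueSetoid (Sum.inl x)

/-- The point of `W₂` with coordinates `(ξ, v₁, v₂)` in the chart `V`. -/
def ptV (x : C3) : W2 := Quotient.mk glueSetoid (Sum.inr x)

lemma ptU_eq_ptV_iff {x y : C3} : ptU x = ptV y ↔ x 0 ≠ 0 ∧ y = tau x :=
  Quotient.eq (r := glueSetoid)

lemma ptU_eq_ptV {x : C3} (hx : x 0 ≠ 0) : ptU x = ptV (tau x) :=
  ptU_eq_ptV_iff.2 ⟨hx, rfl⟩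

lemma ptV_eq_ptU {x : C3} (hx : x 0 ≠ 0) : ptV x = ptU (tau x) :=
  (Quotient.eq (r := glueSetoid)).2 ⟨hx, rfl⟩

lemma exists_rep (p : W2) : (∃ x, ptU x = p) ∨ ∃ x, ptV x = p := by
  induction p using Quotient.inductionOn with
  | h a => rcases a with x | x
           · exact Or.inl ⟨x, rfl⟩
           · exact Or.inr ⟨x, rfl⟩

/-- The coordinates `(z, u₁, u₂)`; a junk value outside `U`. -/
def coordU : W2 → C3 :=
  Quotient.lift (Sum.elim id tau) (by
    intro a b h
    rcases a with x | x <;> rcases b with y | y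
    · exact h
    · obtain ⟨h0, rfl⟩ := h
      exact (tau_tau h0).symm
    · obtain ⟨h0, rfl⟩ := h
      rfl
    · exact congrArg tau h)

/-- The coordinates `(ξ, v₁, v₂)`; a junk value outside `V`. -/
def coordV : W2 → C3 :=
  Quotient.lift (Sum.elim tau id) (by
    intro a b h
    rcases a with x | x <;> rcases b with y | y
    · exact congrArg tau h
    · obtain ⟨h0, rfl⟩ := h
      rfl
    · obtain ⟨h0, rfl⟩ := h
      exact (tau_tau h0).symm
    · exact h)

@[simp] lemma coordU_ptU (x : C3) : coordU (ptU x) = x := rfl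
@[simp] lemma coordU_ptV (x : C3) : coordU (ptV x) = tau x := rfl
@[simp] lemma coordV_ptV (x : C3) : coordV (ptV x) = x := rfl
@[simp] lemma coordV_ptU (x : C3) : coordV (ptU x) = tau x := rfl

/-- The chart `U ≅ ℂ³`. -/
def chartU : PartialEquiv W2 C3 where
  toFun := coordU
  invFun := ptU
  source := Set.range ptU
  target := Set.univ
  map_source' _ _ := Set.mem_univ _
  map_target' x _ := Set.mem_range_self x
  left_inv' := by rintro _ ⟨x, rfl⟩; rfl
  right_inv' _ _ := rfl

/-- The chart `V ≅ ℂ³`. -/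
def chartV : PartialEquiv W2 C3 where
  toFun := coordV
  invFun := ptV
  source := Set.range ptV
  target := Set.univ
  map_source' _ _ := Set.mem_univ _
  map_target' x _ := Set.mem_range_self x
  left_inv' := by rintro _ ⟨x, rfl⟩; rfl
  right_inv' _ _ := rfl

lemma ptU_mem_range_ptV {x : C3} : ptU x ∈ Set.range ptV ↔ x 0 ≠ 0 :=
  ⟨fun ⟨_, hy⟩ => (ptU_eq_ptV_iff.1 hy.symm).1, fun h => ⟨_, (ptU_eq_ptV h).symm⟩⟩

lemma ptV_mem_range_ptU {x : C3} : ptV x ∈ Set.range ptU ↔ x 0 ≠ 0 := by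
  refine ⟨fun ⟨y, hy⟩ => ?_, fun h => ⟨_, (ptV_eq_ptU h).symm⟩⟩
  obtain ⟨h0, rfl⟩ := ptU_eq_ptV_iff.1 hy
  simpa using h0

lemma isOpen_ne : IsOpen {x : C3 | x 0 ≠ 0} :=
  isOpen_ne_fun (continuous_apply 0) continuous_const

lemma contDiffOn_tau : ContDiffOn ℂ ω tau {x : C3 | x 0 ≠ 0} := by
  rw [contDiffOn_pi]
  intro i
  have h (j : Fin 3) : ContDiffOn ℂ ω (fun x : C3 => x j) {x : C3 | x 0 ≠ 0} :=
    (contDiff_apply ℂ ℂ j).contDiffOn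
  fin_cases i
  · exact (h 0).inv fun x hx => hx
  · exact ((h 0).pow 2).mul (h 1)
  · exact h 2

lemma source_UV : (chartU.symm.trans chartV).source = {x : C3 | x 0 ≠ 0} := by
  ext x
  simp only [PartialEquiv.trans_source, PartialEquiv.symm_source, Set.mem_inter_iff,
    Set.mem_preimage]
  exact ⟨fun h => ptU_mem_range_ptV.1 h.2, fun h => ⟨Set.mem_univ _, ptU_mem_range_ptV.2 h⟩⟩

lemma source_VU : (chartV.symm.trans chartU).source = {x : C3 | x 0 ≠ 0} := by
  ext x
  simp only [PartialEquiv.trans_source, PartialEquiv.symm_source, Set.mem_inter_iff,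
    Set.mem_preimage]
  exact ⟨fun h => ptV_mem_range_ptU.1 h.2, fun h => ⟨Set.mem_univ _, ptV_mem_range_ptU.2 h⟩⟩

/-- The two charts are compatible: their changes of coordinates are holomorphic on open sets. -/
lemma chart_compat (e e' : PartialEquiv W2 C3) (he : e ∈ ({chartU, chartV} : Set _))
    (he' : e' ∈ ({chartU, chartV} : Set _)) :
    IsOpen (e.symm.trans e').source ∧
      ContDiffOn ℂ ω (e.symm.trans e') (e.symm.trans e').source := by
  rcases he with rfl | rfl <;> rcases he' with rfl | rfl
  · have h : (chartU.symm.trans chartU).source = Set.univ := by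
      ext x
      exact ⟨fun _ => Set.mem_univ _, fun _ => ⟨Set.mem_univ _, Set.mem_range_self x⟩⟩
    rw [h]
    exact ⟨isOpen_univ, contDiff_id.contDiffOn⟩
  · rw [source_UV]
    exact ⟨isOpen_ne, contDiffOn_tau⟩
  · rw [source_VU]
    exact ⟨isOpen_ne, contDiffOn_tau⟩
  · have h : (chartV.symm.trans chartV).source = Set.univ := by
      ext x
      exact ⟨fun _ => Set.mem_univ _, fun _ => ⟨Set.mem_univ _, Set.mem_range_self x⟩⟩
    rw [h]
    exact ⟨isOpen_univ, contDiff_id.contDiffOn⟩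

open Classical in
/-- The atlas `{U, V}` of `W₂`. -/
def w2Core : ChartedSpaceCore C3 W2 where
  atlas := {chartU, chartV}
  chartAt p := if p ∈ Set.range ptU then chartU else chartV
  mem_chart_source p := by
    by_cases h : p ∈ Set.range ptU
    · rw [if_pos h]; exact h
    · rw [if_neg h]; exact (exists_rep p).resolve_left h
  chart_mem_atlas p := by
    by_cases h : p ∈ Set.range ptU <;> simp [h]
  open_source e e' he he' := (chart_compat e e' he he').1
  continuousOn_toFun e e' he he' := (chart_compat e e' he he').2.continuousOn

instance : TopologicalSpace W2 := w2Core.toTopologicalSpace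

instance : ChartedSpace C3 W2 := w2Core.toChartedSpace

/-- `W₂` is a complex manifold of dimension three. -/
instance : IsManifold 𝓘(ℂ, C3) ω W2 := by
  refine isManifold_of_contDiffOn 𝓘(ℂ, C3) ω W2 ?_
  intro e e' he he'
  obtain ⟨f, hf, hef⟩ : ∃ f, ∃ h : f ∈ w2Core.atlas, e = w2Core.openPartialHomeomorph f h := by
    have h : e ∈ ⋃ (e : PartialEquiv W2 C3) (he : e ∈ w2Core.atlas),
      {w2Core.openPartialHomeomorph e he} := he
    simpa using h
  obtain ⟨f', hf', hef'⟩ :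
      ∃ f, ∃ h : f ∈ w2Core.atlas, e' = w2Core.openPartialHomeomorph f h := by
    have h : e' ∈ ⋃ (e : PartialEquiv W2 C3) (he : e ∈ w2Core.atlas),
      {w2Core.openPartialHomeomorph e he} := he'
    simpa using h
  subst hef hef'
  have key := (chart_compat f f' hf hf').2
  refine key.mono ?_
  intro x hx
  exact hx.1

/-- The open set `U ⊆ W₂`. -/
def U : TopologicalSpace.Opens W2 :=
  ⟨Set.range ptU, w2Core.open_source' (e := chartU) (Or.inl rfl)⟩

/-- The open set `V ⊆ W₂`. -/
def V : TopologicalSpace.Opens W2 :=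
  ⟨Set.range ptV, w2Core.open_source' (e := chartV) (Or.inr rfl)⟩

/-! ### The endomorphism bundle of the tangent bundle and its first Čech cohomology -/

/-- The holomorphic tangent space of `W₂` at `p`. -/
abbrev T (p : W2) : Type := TangentSpace 𝓘(ℂ, C3) p

/-- The fibre at `p` of the bundle `End(TW₂)`. -/
abbrev EndT (p : W2) : Type := T p →L[ℂ] T p

open Classical in
/-- Extension by zero of a section over `O`. -/
def extend {O : TopologicalSpace.Opens W2} (s : ∀ p : O, EndT p) (p : W2) : EndT p :=
  if h : p ∈ O then s ⟨p, h⟩ else 0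

/-- `s` is a holomorphic section of `End(TW₂)` over the open set `O`. -/
def IsHolSection (O : TopologicalSpace.Opens W2) (s : ∀ p : O, EndT p) : Prop :=
  MDifferentiableOn 𝓘(ℂ, C3) (𝓘(ℂ, C3).prod 𝓘(ℂ, C3 →L[ℂ] C3))
    (fun p : W2 => TotalSpace.mk' (C3 →L[ℂ] C3) (E := EndT) p (extend s p)) O

/-- The space `Γ(O, End(TW₂))` of holomorphic sections over `O`. -/
def sections (O : TopologicalSpace.Opens W2) : Submodule ℂ (∀ p : O, EndT p) where
  carrier := {s | IsHolSection O s}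
  zero_mem' := by
    have h : extend (0 : ∀ p : O, EndT p) = 0 := by
      funext p; simp [extend]
    simp only [Set.mem_ofPred_eq, IsHolSection, h]
    exact mdifferentiableOn_zeroSection ℂ EndT
  add_mem' := by
    intro s t hs ht
    have h : extend (s + t) = extend s + extend t := by
      funext p
      by_cases hp : p ∈ O <;> simp [extend, hp]
    simp only [Set.mem_ofPred_eq, IsHolSection, h] at hs ht ⊢
    exact mdifferentiableOn_add_section hs ht
  smul_mem' := by
    intro c s hs
    have h : extend (c • s) = c • extend s := by
      funext p
      by_cases hp : p ∈ O <;> simp [extend, hp]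
    simp only [Set.mem_ofPred_eq, IsHolSection, h] at hs ⊢
    exact MDifferentiableOn.smul_const_section hs

/-- Restriction of holomorphic sections to a smaller open set. -/
def res {O O' : TopologicalSpace.Opens W2} (h : O' ≤ O) : sections O →ₗ[ℂ] sections O' where
  toFun s := ⟨fun p => s.1 ⟨p.1, h p.2⟩, by
    refine (MDifferentiableOn.mono s.2 h).congr ?_
    intro p hp
    have hp' : p ∈ O' := hp
    simp [extend, hp', h hp']⟩
  map_add' _ _ := rfl
  map_smul' _ _ := rfl

/-- The Čech differential `(a, b) ↦ b|_{U ∩ V} - a|_{U ∩ V}` from `0`-cochains to `1`-cochains of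
`End(TW₂)` for the covering of `W₂` by `U` and `V`. -/
def cechD : (sections U × sections V) →ₗ[ℂ] sections (U ⊓ V) :=
  (res inf_le_right).comp (LinearMap.snd ℂ _ _) - (res inf_le_left).comp (LinearMap.fst ℂ _ _)

/-- `H¹(W₂, End(TW₂))`, computed by the Čech complex of the covering `{U, V}`: as there are no
triple intersections every section over `U ∩ V` is a `1`-cocycle. -/
abbrev H1 : Type := sections (U ⊓ V) ⧸ LinearMap.range cechD

/-- The class in `H¹(W₂, End(TW₂))` of a cocycle. -/
def cls : sections (U ⊓ V) →ₗ[ℂ] H1 := (LinearMap.range cechD).mkQ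

/-! ### The Zariski tangent space of the moduli at `TW₂` -/

/-- A holomorphic automorphism of `TW₂[ε] = TW₂ ⊗ ℂ[ε]` over `O`, where `ε² = 0`, that reduces to
the identity modulo `ε`. -/
structure InfAut (O : TopologicalSpace.Opens W2) where
  /-- The automorphism at each point, an element of `(End T_p W₂)[ε]`. -/
  val : ∀ p : O, DualNumber (EndT p)
  fst_eq : ∀ p, (val p).fst = 1
  snd_hol : IsHolSection O fun p => (val p).snd

/-- A first-order deformation of the holomorphic bundle `TW₂`: a bundle over `W₂ × Spec ℂ[ε]`
that restricts to `TW₂` modulo `ε`, presented by gluing `TW₂[ε]|_U` to `TW₂[ε]|_V` over `U ∩ V` by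
an automorphism that is the identity modulo `ε`. -/
abbrev FirstOrderDeformation : Type := InfAut (U ⊓ V)

/-- The cocycle of a first-order deformation, i.e. the `ε`-part of its gluing. -/
def FirstOrderDeformation.cocycle (g : FirstOrderDeformation) : sections (U ⊓ V) :=
  ⟨fun p => (g.val p).snd, g.snd_hol⟩

/-- Isomorphism of first-order deformations: automorphisms of `TW₂[ε]` over `U` and over `V`,
equal to the identity modulo `ε`, that are compatible with the gluings. -/
def FirstOrderDeformation.Iso (g g' : FirstOrderDeformation) : Prop :=
  ∃ (a : InfAut U) (b : InfAut V), ∀ p : (U ⊓ V : TopologicalSpace.Opens W2),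
    b.val ⟨p.1, p.2.2⟩ * g.val p = g'.val p * a.val ⟨p.1, p.2.1⟩

/-- The Zariski tangent space at `TW₂` of the moduli of holomorphic bundles on `W₂`: the
isomorphism classes of first-order deformations of `TW₂`. -/
def ModuliTangentSpace : Type := Quot FirstOrderDeformation.Iso

/-! ### Holomorphic families of bundles -/

/-- A holomorphic family of bundles `E_t` on `W₂`, parametrised by `t ∈ ℂⁿ`, with `E₀ = TW₂`: the
bundle `E_t` is glued from `TW₂|_U` and `TW₂|_V` by the automorphism `θ t` of `TW₂|_{U ∩ V}`, which
is holomorphic in the parameter and the point together. -/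
structure Family (n : ℕ) where
  /-- The gluing. -/
  θ : (Fin n → ℂ) → ∀ p : (U ⊓ V : TopologicalSpace.Opens W2), EndT p
  hol : MDifferentiableOn (𝓘(ℂ, Fin n → ℂ).prod 𝓘(ℂ, C3))
    (𝓘(ℂ, C3).prod 𝓘(ℂ, C3 →L[ℂ] C3))
    (fun x : (Fin n → ℂ) × W2 =>
      TotalSpace.mk' (C3 →L[ℂ] C3) (E := EndT) x.2 (extend (θ x.1) x.2))
    (Set.univ ×ˢ ((U ⊓ V : TopologicalSpace.Opens W2) : Set W2))
  isUnit : ∀ t p, IsUnit (θ t p)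
  zero : ∀ p, θ 0 p = 1

/-- `κ` is the Kodaira–Spencer map at `t = 0` of the family, on the level of cocycles: `κ v` is the
derivative of the gluing at `t = 0` in the direction `v`. -/
def Family.IsKodairaSpencer {n : ℕ} (𝓔 : Family n) (κ : (Fin n → ℂ) →ₗ[ℂ] sections (U ⊓ V)) :
    Prop :=
  ∀ v p, HasDerivAt (fun s : ℂ => 𝓔.θ (s • v) p) ((κ v).1 p) 0

/-! ### The generators -/

/-- The endomorphism of `T_p W₂` with matrix `M` in the frame `∂/∂z, ∂/∂u₁, ∂/∂u₂` of the chart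
`U` (acting on column vectors). -/
def ofMatrixU (p : W2) (M : Matrix (Fin 3) (Fin 3) ℂ) : EndT p :=
  (mfderiv 𝓘(ℂ, C3) 𝓘(ℂ, C3) ptU (coordU p) : C3 →L[ℂ] C3) ∘L
    (LinearMap.toContinuousLinearMap (Matrix.toLin' M) : C3 →L[ℂ] C3) ∘L
      (mfderiv 𝓘(ℂ, C3) 𝓘(ℂ, C3) coordU p : C3 →L[ℂ] C3)

/-- The matrices of the generating cocycles at `x = (z, u₁, u₂)`. If the nine entries of a matrix
are numbered row by row, the positions used are number 4 (second row, first column), number 6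
(second row, third column) and number 7 (third row, first column). -/
def genMatrix (m : Fin 6) (k : ℕ) (x : C3) : Matrix (Fin 3) (Fin 3) ℂ :=
  match m with
  | 0 => Matrix.single 1 0 ((x 0)⁻¹ * x 1 * x 2 ^ k)
  | 1 => Matrix.single 1 0 ((x 0)⁻¹ * x 2 ^ k)
  | 2 => Matrix.single 1 0 ((x 0 ^ 2)⁻¹ * x 2 ^ k)
  | 3 => Matrix.single 1 0 ((x 0 ^ 3)⁻¹ * x 2 ^ k)
  | 4 => Matrix.single 1 2 ((x 0)⁻¹ * x 2 ^ k)
  | 5 => Matrix.single 2 0 ((x 0)⁻¹ * x 2 ^ k)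

/-- The generating cocycles, as sections of `End(TW₂)` over `U ∩ V`. -/
def gen (i : Fin 6 × ℕ) (p : (U ⊓ V : TopologicalSpace.Opens W2)) : EndT p :=
  ofMatrixU p (genMatrix i.1 i.2 (coordU p))

end LocalCY

end

/-! Over `U ∩ V` an endomorphism is a matrix `M` in the frame of `U`; in the frame of `V` it becomes
`J M J⁻¹`, where `J` is the Jacobian of `tau`. Hence (`mem_range_cechD_iff`) a cocycle is a
coboundary exactly when `M - A = J⁻¹ (B ∘ tau) J` with `A`, `B` entire, and the cohomology is a
question about functions on `z ≠ 0`.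

The matrix `J` is lower triangular with diagonal `(-z⁻², z², 1)`, as for 𝒪(2) ⊕ 𝒪(-2) ⊕ 𝒪. Up to
corrections from the entry below the diagonal, the position `E₂₁` behaves like 𝒪(-4), the positions
`E₂₃` and `E₃₁` like 𝒪(-2), and the other six have degree ≥ 0 and contribute nothing. A Laurent
monomial `z⁻ⁱ u₁ʲ` with `i ≥ 1` equals `ξ^(i+2j) v₁ʲ`, so in degree `-d` it extends to `V` as soon
as `i + 2j ≥ d`. What survives is `z⁻¹` for `d = 2`, and `z⁻¹u₁, z⁻¹, z⁻², z⁻³` for `d = 4`, each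
with an entire function of `u₂` as coefficient (`exists_normal_form`). Taylor expansion of these
coefficients gives generation.

For infinite dimension, `z⁻¹ h(u₂) E₂₃` is restricted to the line `u₁ = 0, u₂ = t`; if it is a
coboundary, Liouville's theorem forces `h(t) = 0` (`eq_zero_of_mem_range`). As `E₂₃² = 0`, the
matrices `1 + z⁻¹ p(u₂) E₂₃` are invertible and glue families with injective Kodaira–Spencer map.
Finally, the `ε`-part of `(1 + εb)(1 + εg) = (1 + εg')(1 + εa)` reads `b - a = g' - g`, so
isomorphic deformations are the cohomologous ones. -/

noncomputable section

namespace LocalCY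

/-! ### Cauchy integrals and Laurent decomposition -/

section

open MeasureTheory Metric Set

/-- A circle integral depending holomorphically on parameters is holomorphic in them. -/
theorem differentiableAt_circleIntegral {K : C3 → ℂ → ℂ} {Ω : Set (C3 × ℂ)} (hΩ : IsOpen Ω)
    (hK : DifferentiableOn ℂ (fun p : C3 × ℂ => K p.1 p.2) Ω) {R : ℝ} (hR : 0 < R) {x₀ : C3}
    (hx : ∀ w ∈ sphere (0 : ℂ) R, (x₀, w) ∈ Ω) :
    DifferentiableAt ℂ (fun x => ∮ w in C(0, R), K x w) x₀ := by
  have hKc := hK.continuousOn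
  have hc₀ : ContinuousOn (fun w => K x₀ w) (sphere (0 : ℂ) R) :=
    hKc.comp (f := fun w : ℂ => (x₀, w)) (by fun_prop) hx
  obtain ⟨M, hM⟩ := (isCompact_sphere (0 : ℂ) R).exists_bound_of_continuousOn hc₀
  -- The open set where the kernel is smaller than `M + 1` contains `{x₀}` times the circle. The
  -- tube lemma then gives one ball around `x₀` on which the kernel is bounded uniformly along the
  -- circle.
  have hΩ' : IsOpen (Ω ∩ (fun p : C3 × ℂ => K p.1 p.2) ⁻¹' ball 0 (M + 1)) :=
    hKc.isOpen_inter_preimage hΩ isOpen_ball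
  obtain ⟨u, v, hu, -, hxu, hsv, huv⟩ := generalized_tube_lemma (isCompact_singleton (x := x₀))
    (isCompact_sphere (0 : ℂ) R) hΩ' (by
      rintro ⟨x, w⟩ ⟨rfl, hw⟩
      refine ⟨hx w hw, ?_⟩
      exact mem_ball_zero_iff.2 ((hM w hw).trans_lt (lt_add_one M)))
  obtain ⟨ε, hε, hεu⟩ := Metric.mem_nhds_iff.1 (hu.mem_nhds (hxu rfl))
  have hmem : ∀ x ∈ ball x₀ ε, ∀ w ∈ sphere (0 : ℂ) R, (x, w) ∈ Ω ∧ ‖K x w‖ < M + 1 := by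
    intro x hx w hw
    have := huv (mk_mem_prod (hεu hx) (hsv hw))
    exact ⟨this.1, by simpa using this.2⟩
  have hcont : ∀ x ∈ ball x₀ ε, Continuous fun θ : ℝ => deriv (circleMap 0 R) θ •
      K x (circleMap 0 R θ) := by
    intro x hx
    have h0 : Continuous fun θ : ℝ => deriv (circleMap 0 R) θ := by
      simp only [deriv_circleMap]; fun_prop
    refine h0.smul ?_
    have : ContinuousOn (fun θ : ℝ => K x (circleMap 0 R θ)) univ :=
      hKc.comp (f := fun θ : ℝ => (x, circleMap 0 R θ)) (by fun_prop)
        fun θ _ => (hmem x hx _ (circleMap_mem_sphere 0 hR.le θ)).1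
    exact continuousOn_univ.1 this
  have hder : ∀ θ : ℝ, HasFDerivAt (fun x => K x (circleMap 0 R θ))
      ((fderiv ℂ (fun p : C3 × ℂ => K p.1 p.2) (x₀, circleMap 0 R θ)).comp
        (ContinuousLinearMap.inl ℂ C3 ℂ)) x₀ := by
    intro θ
    have h1 := (hK.differentiableAt (hΩ.mem_nhds
      (hx _ (circleMap_mem_sphere 0 hR.le θ)))).hasFDerivAt
    exact HasFDerivAt.comp (f := fun x : C3 => (x, circleMap 0 R θ)) x₀ h1
      (hasFDerivAt_prodMk_left x₀ (circleMap 0 R θ))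
  have key := hasFDerivAt_integral_of_dominated_loc_of_lip' (𝕜 := ℂ)
    (μ := volume.restrict (Ioc 0 (2 * Real.pi))) (x₀ := x₀)
    (F := fun x θ => deriv (circleMap 0 R) θ • K x (circleMap 0 R θ))
    (F' := fun θ => deriv (circleMap 0 R) θ •
      (fderiv ℂ (fun p : C3 × ℂ => K p.1 p.2) (x₀, circleMap 0 R θ)).comp
        (ContinuousLinearMap.inl ℂ C3 ℂ))
    (bound := fun _ => R * (2 * (M + 1) / ε)) (ball_mem_nhds x₀ hε)
    (fun x hx => (hcont x hx).aestronglyMeasurable)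
    ((hcont x₀ (mem_ball_self hε)).integrableOn_Ioc)
    (by
      apply Measurable.aestronglyMeasurable
      have h0 : Measurable fun θ : ℝ => deriv (circleMap 0 R) θ := by
        simp only [deriv_circleMap]; fun_prop
      refine h0.smul (g := fun θ : ℝ => (fderiv ℂ (fun p : C3 × ℂ => K p.1 p.2)
        (x₀, circleMap 0 R θ)).comp (ContinuousLinearMap.inl ℂ C3 ℂ)) ?_
      · have h1 : Measurable fun θ : ℝ => fderiv ℂ (fun p : C3 × ℂ => K p.1 p.2)
            (x₀, circleMap 0 R θ) :=
          (measurable_fderiv ℂ _).comp (by fun_prop)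
        have h2 : Continuous fun L : (C3 × ℂ) →L[ℂ] ℂ =>
          L.comp (ContinuousLinearMap.inl ℂ C3 ℂ) := by fun_prop
        exact h2.measurable.comp h1)
    (by
      refine Filter.Eventually.of_forall fun θ x hx => ?_
      have hs := circleMap_mem_sphere (0 : ℂ) hR.le θ
      rw [← smul_sub, norm_smul]
      have h1 : ‖deriv (circleMap 0 R) θ‖ = R := by simp [abs_of_pos hR]
      rw [h1, mul_assoc]
      gcongr
      rw [← dist_eq_norm, ← dist_eq_norm]
      -- By the Schwarz lemma, a bound on the kernel gives a Lipschitz bound at the centre: the ball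
      -- of radius `ε` goes into one of radius `2 (M + 1)`. No estimate of the derivative is needed.
      refine Complex.dist_le_div_mul_dist_of_mapsTo_ball
        (f := fun x => K x (circleMap 0 R θ)) ?_ ?_ hx
      · exact hK.comp (f := fun x : C3 => (x, circleMap 0 R θ)) (by fun_prop)
          fun y hy => (hmem y hy _ hs).1
      · intro y hy
        rw [mem_closedBall, dist_eq_norm]
        have := norm_sub_le (K y (circleMap 0 R θ)) (K x₀ (circleMap 0 R θ))
        linarith [(hmem y hy _ hs).2, (hmem x₀ (mem_ball_self hε) _ hs).2])
    (integrable_const _)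
    (Filter.Eventually.of_forall fun θ => (hder θ).fun_const_smul _)
  have h2 := key.2.differentiableAt
  refine h2.congr_of_eventuallyEq (Filter.Eventually.of_forall fun x => ?_)
  simp only [circleIntegral]
  rw [intervalIntegral.integral_of_le Real.two_pi_pos.le]

theorem circleIntegral_eq_of_differentiableOn {r R : ℝ} (hr : 0 < r) (hrR : r ≤ R) {f : ℂ → ℂ}
    {s : Set ℂ} (hs : IsOpen s) (hf : DifferentiableOn ℂ f s)
    (hsub : ∀ w : ℂ, r ≤ ‖w‖ → ‖w‖ ≤ R → w ∈ s) :
    (∮ w in C(0, R), f w) = ∮ w in C(0, r), f w := by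
  refine Complex.circleIntegral_eq_of_differentiable_on_annulus_off_countable hr hrR
    countable_empty (hf.continuousOn.mono fun w hw => ?_) fun w hw => ?_
  · exact hsub w (by simpa using hw.2) (by simpa using hw.1)
  · have h1 : ‖w‖ < R := by simpa using hw.1.1
    have h2 : r < ‖w‖ := by simpa using hw.1.2
    exact hf.differentiableAt (hs.mem_nhds (hsub w h2.le h1.le))

/-- The Cauchy integral formula for an annulus. -/
theorem cauchy_annulus {f : ℂ → ℂ} (hf : DifferentiableOn ℂ f {0}ᶜ) {r R : ℝ} {z : ℂ} (hr : 0 < r)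
    (hrz : r < ‖z‖) (hzR : ‖z‖ < R) :
    (2 * Real.pi * Complex.I) * f z =
      (∮ w in C(0, R), f w * (w - z)⁻¹) - ∮ w in C(0, r), f w * (w - z)⁻¹ := by
  have hz : z ≠ 0 := norm_pos_iff.1 (hr.trans hrz)
  have hR : 0 < R := (norm_nonneg z).trans_lt hzR
  -- The difference quotient of `f` at `z` has no singularity at `z`, so its integrals over the two
  -- circles agree; expanding it on each circle gives the formula.
  have hd : DifferentiableOn ℂ (dslope f z) {0}ᶜ :=
    (Complex.differentiableOn_dslope (isOpen_compl_singleton.mem_nhds hz)).2 hf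
  have h1 : (∮ w in C(0, R), dslope f z w) = ∮ w in C(0, r), dslope f z w :=
    circleIntegral_eq_of_differentiableOn hr (hrz.trans hzR).le isOpen_compl_singleton hd
      fun w hw _ => norm_pos_iff.1 (hr.trans_le hw)
  have h2 : ∀ ρ : ℝ, 0 < ρ → ρ ≠ ‖z‖ → (∮ w in C(0, ρ), dslope f z w) =
      (∮ w in C(0, ρ), f w * (w - z)⁻¹) - f z * ∮ w in C(0, ρ), (w - z)⁻¹ := by
    intro ρ hρ hne
    have hwz : ∀ w ∈ sphere (0 : ℂ) ρ, w ≠ z := by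
      rintro w hw rfl
      exact hne (by simpa using hw.symm)
    have hci : ContinuousOn (fun w => (w - z)⁻¹) (sphere (0 : ℂ) ρ) :=
      ContinuousOn.inv₀ (by fun_prop) fun w hw => sub_ne_zero.2 (hwz w hw)
    have hcf : ContinuousOn f (sphere (0 : ℂ) ρ) := hf.continuousOn.mono fun w hw => by
      rintro rfl
      exact hρ.ne (by simpa using hw)
    rw [← circleIntegral.integral_const_mul, ← circleIntegral.integral_sub]
    · refine circleIntegral.integral_congr hρ.le fun w hw => ?_
      rw [dslope_of_ne _ (hwz w hw), slope_def_field]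
      ring
    · exact (hcf.mul hci).circleIntegrable hρ.le
    · exact (continuousOn_const.mul hci).circleIntegrable hρ.le
  rw [h2 R hR hzR.ne', h2 r hr hrz.ne] at h1
  rw [circleIntegral.integral_sub_inv_of_mem_ball (by simpa using hzR)] at h1
  have h3 : (∮ w in C(0, r), (w - z)⁻¹) = 0 := by
    refine DiffContOnCl.circleIntegral_eq_zero hr.le (DifferentiableOn.diffContOnCl ?_)
    rw [closure_ball _ hr.ne']
    refine DifferentiableOn.inv (by fun_prop) fun w hw => sub_ne_zero.2 ?_
    rintro rfl
    exact absurd (mem_closedBall_zero_iff.1 hw) (not_le.2 hrz)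
  rw [h3] at h1
  linear_combination -h1

/-- Replacing a coordinate is holomorphic. -/
theorem differentiable_update (i : Fin 3) :
    Differentiable ℂ fun p : C3 × ℂ => Function.update p.1 i p.2 := by
  rw [differentiable_pi]
  intro j
  by_cases h : j = i
  · subst h
    simp only [Function.update_self]
    fun_prop
  · simp only [Function.update_of_ne h]
    fun_prop

theorem update_differentiable_right (x : C3) (i : Fin 3) :
    Differentiable ℂ fun w : ℂ => Function.update x i w :=
  (differentiable_update i).comp (f := fun w : ℂ => (x, w)) (by fun_prop)

/-- The Laurent decomposition of a function on `(ℂ ∖ {0}) × ℂ²`. -/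
theorem exists_laurent {f : C3 → ℂ} (hf : DifferentiableOn ℂ f {x | x 0 ≠ 0}) :
    ∃ P g : C3 → ℂ, Differentiable ℂ P ∧ Differentiable ℂ g ∧ ∀ x : C3, x 0 ≠ 0 →
      f x = P x + (x 0)⁻¹ * g (Function.update x 0 (x 0)⁻¹) := by
  have hpi : (2 * Real.pi * Complex.I : ℂ) ≠ 0 := by simp [Real.pi_ne_zero]
  have hF : DifferentiableOn ℂ (fun p : C3 × ℂ => f (Function.update p.1 0 p.2)) {p | p.2 ≠ 0} :=
    hf.comp (differentiable_update 0).differentiableOn fun p hp => by simpa using hp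
  have hφ : ∀ x : C3, DifferentiableOn ℂ (fun w => f (Function.update x 0 w)) {0}ᶜ := fun x =>
    hF.comp (f := fun w : ℂ => (x, w)) (by fun_prop) fun w hw => hw
  have hn0 : IsOpen {p : C3 × ℂ | p.2 ≠ 0} := isOpen_ne_fun continuous_snd continuous_const
  -- `K₁` is the Cauchy kernel on the outer circle. `K₂` is the one on the inner circle, rewritten
  -- with `ξ = z⁻¹` through `-(w - z)⁻¹ = z⁻¹ (1 - z⁻¹ w)⁻¹`, so that it stays regular at `ξ = 0`.
  let K₁ : C3 → ℂ → ℂ := fun x w => f (Function.update x 0 w) * (w - x 0)⁻¹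
  let K₂ : C3 → ℂ → ℂ := fun x w => f (Function.update x 0 w) * (1 - x 0 * w)⁻¹
  have hΩ₁ : IsOpen {p : C3 × ℂ | p.2 ≠ 0 ∧ p.2 - p.1 0 ≠ 0} :=
    hn0.inter (isOpen_ne_fun (by fun_prop) continuous_const)
  have hΩ₂ : IsOpen {p : C3 × ℂ | p.2 ≠ 0 ∧ 1 - p.1 0 * p.2 ≠ 0} :=
    hn0.inter (isOpen_ne_fun (by fun_prop) continuous_const)
  have hK₁ : DifferentiableOn ℂ (fun p : C3 × ℂ => K₁ p.1 p.2)
      {p : C3 × ℂ | p.2 ≠ 0 ∧ p.2 - p.1 0 ≠ 0} :=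
    (hF.mono fun p hp => hp.1).mul (DifferentiableOn.inv (by fun_prop) fun p hp => hp.2)
  have hK₂ : DifferentiableOn ℂ (fun p : C3 × ℂ => K₂ p.1 p.2)
      {p : C3 × ℂ | p.2 ≠ 0 ∧ 1 - p.1 0 * p.2 ≠ 0} :=
    (hF.mono fun p hp => hp.1).mul (DifferentiableOn.inv (by fun_prop) fun p hp => hp.2)
  have hs₁ : ∀ (x : C3) (w : ℂ), ‖x 0‖ < ‖w‖ → w ≠ 0 ∧ w - x 0 ≠ 0 := fun x w h =>
    ⟨norm_pos_iff.1 ((norm_nonneg _).trans_lt h), sub_ne_zero.2 fun h' => by simp [h'] at h⟩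
  have hs₂ : ∀ (x : C3) (w : ℂ), w ≠ 0 → ‖x 0‖ * ‖w‖ < 1 → w ≠ 0 ∧ 1 - x 0 * w ≠ 0 :=
    fun x w hw h => ⟨hw, sub_ne_zero.2 fun h' => by
      rw [← norm_mul, ← h'] at h
      simp at h⟩
  have hfix₁ : ∀ (x : C3) (r R : ℝ), ‖x 0‖ < r → r ≤ R →
      (∮ w in C(0, R), K₁ x w) = ∮ w in C(0, r), K₁ x w := fun x r R hr hrR =>
    circleIntegral_eq_of_differentiableOn ((norm_nonneg _).trans_lt hr) hrR
      (hΩ₁.preimage (f := fun w : ℂ => (x, w)) (by fun_prop))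
      (hK₁.comp (f := fun w : ℂ => (x, w)) (by fun_prop) fun w hw => hw)
      fun w hw _ => hs₁ x w (hr.trans_le hw)
  have hfix₂ : ∀ (x : C3) (r R : ℝ), 0 < r → r ≤ R → ‖x 0‖ * R < 1 →
      (∮ w in C(0, R), K₂ x w) = ∮ w in C(0, r), K₂ x w := fun x r R hr hrR hR =>
    circleIntegral_eq_of_differentiableOn hr hrR
      (hΩ₂.preimage (f := fun w : ℂ => (x, w)) (by fun_prop))
      (hK₂.comp (f := fun w : ℂ => (x, w)) (by fun_prop) fun w hw => hw)
      fun w hw hw' => hs₂ x w (norm_pos_iff.1 (hr.trans_le hw))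
        ((mul_le_mul_of_nonneg_left hw' (norm_nonneg _)).trans_lt hR)
  have hnear : ∀ x₀ : C3, ∀ᶠ x in 𝓝 x₀, ‖x 0‖ < ‖x₀ 0‖ + 1 := fun x₀ =>
    (isOpen_lt (by fun_prop) continuous_const).mem_nhds (lt_add_one ‖x₀ 0‖)
  have hrad : ∀ a : ℝ, 0 ≤ a → a * (a + 1)⁻¹ < 1 := fun a ha => by
    rw [← div_eq_mul_inv, div_lt_one (by linarith)]
    linarith
  -- The radii vary with `x` in order to define `P` and `g` everywhere. Near a given point `hfix₁`
  -- and `hfix₂` replace them by a constant radius, where the integral is differentiable.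
  refine ⟨fun x => (2 * Real.pi * Complex.I)⁻¹ * ∮ w in C(0, ‖x 0‖ + 1), K₁ x w,
    fun x => (2 * Real.pi * Complex.I)⁻¹ * ∮ w in C(0, (‖x 0‖ + 1)⁻¹), K₂ x w,
    fun x₀ => ?_, fun x₀ => ?_, fun x hx => ?_⟩
  · have h1 : DifferentiableAt ℂ (fun x => ∮ w in C(0, ‖x₀ 0‖ + 2), K₁ x w) x₀ := by
      refine differentiableAt_circleIntegral hΩ₁ hK₁ (by positivity) fun w hw => hs₁ x₀ w ?_
      rw [mem_sphere_zero_iff_norm.1 hw]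
      linarith
    refine (h1.const_mul (2 * Real.pi * Complex.I)⁻¹).congr_of_eventuallyEq ?_
    filter_upwards [hnear x₀] with x hx
    rw [hfix₁ x (‖x 0‖ + 1) (‖x₀ 0‖ + 2) (by linarith) (by linarith)]
  · have h1 : DifferentiableAt ℂ (fun x => ∮ w in C(0, (‖x₀ 0‖ + 2)⁻¹), K₂ x w) x₀ := by
      refine differentiableAt_circleIntegral hΩ₂ hK₂ (by positivity) fun w hw => hs₂ x₀ w ?_ ?_
      · rintro rfl
        have : (0 : ℝ) < (‖x₀ 0‖ + 2)⁻¹ := by positivity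
        simp at hw
        linarith [norm_nonneg (x₀ 0)]
      · rw [mem_sphere_zero_iff_norm.1 hw, ← div_eq_mul_inv, div_lt_one (by positivity)]
        linarith
    refine (h1.const_mul (2 * Real.pi * Complex.I)⁻¹).congr_of_eventuallyEq ?_
    filter_upwards [hnear x₀] with x hx
    rw [hfix₂ x (‖x₀ 0‖ + 2)⁻¹ (‖x 0‖ + 1)⁻¹ (by positivity)
      (inv_anti₀ (by positivity) (by linarith)) (hrad _ (norm_nonneg _))]
  · have hx' : 0 < ‖x 0‖ := norm_pos_iff.2 hx
    have hr : (‖(x 0)⁻¹‖ + 1)⁻¹ < ‖x 0‖ := by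
      rw [inv_lt_comm₀ (by positivity) hx', norm_inv]
      linarith
    have h1 := cauchy_annulus (hφ x) (z := x 0) (r := (‖(x 0)⁻¹‖ + 1)⁻¹) (R := ‖x 0‖ + 1)
      (by positivity) hr (lt_add_one _)
    have h2 : (∮ w in C(0, (‖(x 0)⁻¹‖ + 1)⁻¹), K₂ (Function.update x 0 (x 0)⁻¹) w) =
        -(x 0) * ∮ w in C(0, (‖(x 0)⁻¹‖ + 1)⁻¹), f (Function.update x 0 w) * (w - x 0)⁻¹ := by
      rw [← circleIntegral.integral_const_mul]
      refine circleIntegral.integral_congr (by positivity) fun w hw => ?_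
      simp only [K₂, Function.update_idem, Function.update_self]
      have : w - x 0 ≠ 0 := sub_ne_zero.2 fun h => by
        subst h
        exact hr.ne' (mem_sphere_zero_iff_norm.1 hw)
      have h3 : 1 - (x 0)⁻¹ * w = -((x 0)⁻¹ * (w - x 0)) := by
        field_simp
        ring
      rw [h3]
      field_simp
    simp only [Function.update_self, h2]
    simp only [Function.update_eq_self] at h1
    rw [← mul_right_inj' hpi, h1]
    simp only [K₁]
    field_simp
    ring

/-! ### Division by a coordinate -/

/-- Division with remainder by the first coordinate. -/
theorem exists_division_zero {f : C3 → ℂ} (hf : Differentiable ℂ f) :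
    ∃ q : C3 → ℂ, Differentiable ℂ q ∧ ∀ x, f x = f (Function.update x 0 0) + x 0 * q x := by
  -- In the Laurent decomposition of `f / x₀` the negative part can only be `f(0, ·) / x₀`, which
  -- makes `P` the quotient.
  obtain ⟨P, g, hP, hg, hfg⟩ := exists_laurent (f := fun x => f x * (x 0)⁻¹)
    (hf.differentiableOn.mul (DifferentiableOn.inv (by fun_prop) fun x hx => hx))
  refine ⟨P, hP, fun x => ?_⟩
  by_cases hx : x 0 = 0
  · rw [hx, zero_mul, add_zero, ← hx, Function.update_eq_self]
  have hg' : ∀ ξ : ℂ, ξ ≠ 0 → g (Function.update x 0 ξ) =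
      f (Function.update x 0 ξ⁻¹) - ξ⁻¹ * P (Function.update x 0 ξ⁻¹) := by
    intro ξ hξ
    have := hfg (Function.update x 0 ξ⁻¹) (by simpa using hξ)
    simp only [Function.update_self, Function.update_idem, inv_inv] at this
    field_simp at this ⊢
    linear_combination -this
  have hc : ∀ h : C3 → ℂ, Differentiable ℂ h → Differentiable ℂ fun w => h (Function.update x 0 w) :=
    fun h hh => hh.comp (update_differentiable_right x 0)
  have hlim : Filter.Tendsto (fun ξ => g (Function.update x 0 ξ)) (Filter.cocompact ℂ)
      (𝓝 (f (Function.update x 0 0))) := by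
    have h1 : Filter.Tendsto (fun w => f (Function.update x 0 w) - w * P (Function.update x 0 w))
        (𝓝 0) (𝓝 (f (Function.update x 0 0))) := by
      have := ((hc f hf).fun_sub (differentiable_fun_id.fun_mul (hc P hP))).continuous.tendsto 0
      simpa using this
    have h2 : Filter.Tendsto (fun ξ : ℂ => ξ⁻¹) (Filter.cocompact ℂ) (𝓝 0) := by
      rw [← Metric.cobounded_eq_cocompact]
      exact Filter.tendsto_inv₀_cobounded
    refine (h1.comp h2).congr' ?_
    have h3 : ∀ᶠ ξ : ℂ in Filter.cocompact ℂ, ξ ≠ 0 :=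
      (isCompact_singleton (x := (0 : ℂ))).compl_mem_cocompact
    filter_upwards [h3] with ξ hξ
    exact (hg' ξ hξ).symm
  -- By Liouville's theorem, `g` is constant in its first variable, equal to its limit at infinity.
  have hconst := (hc g hg).apply_eq_of_tendsto_cocompact (x 0)⁻¹ hlim
  have := hfg x hx
  simp only [hconst] at this
  field_simp at this
  linear_combination this

/-- Division with remainder by a coordinate. -/
theorem exists_division (i : Fin 3) {f : C3 → ℂ} (hf : Differentiable ℂ f) :
    ∃ q : C3 → ℂ, Differentiable ℂ q ∧ ∀ x, f x = f (Function.update x i 0) + x i * q x := by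
  -- Swapping coordinates `0` and `i` reduces to the previous case.
  let σ : C3 → C3 := fun x j => x (Equiv.swap 0 i j)
  have hσ : Differentiable ℂ σ := by
    rw [differentiable_pi]
    intro j
    exact differentiable_apply (Equiv.swap 0 i j)
  have hσσ : ∀ x, σ (σ x) = x := fun x => by
    funext j
    simp [σ]
  obtain ⟨q, hq, h⟩ := exists_division_zero (hf.comp hσ)
  refine ⟨q ∘ σ, hq.comp hσ, fun x => ?_⟩
  have h1 := h (σ x)
  have h2 : σ (Function.update (σ x) 0 0) = Function.update x i 0 := by
    funext j
    by_cases hj : j = i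
    · subst hj
      simp [σ]
    · have : Equiv.swap 0 i j ≠ 0 := fun h =>
        hj ((Equiv.swap 0 i).injective (h.trans (Equiv.swap_apply_right 0 i).symm))
      simp [σ, Function.update_of_ne this, Function.update_of_ne hj]
  simpa [hσσ, h2, σ] using h1

end

/-! ### Functions on the overlap modulo functions on the two charts -/

/-- The Laurent decomposition with its negative part written in the coordinates of `V`. -/
theorem exists_add_comp_tau {f : C3 → ℂ} (hf : DifferentiableOn ℂ f {x | x 0 ≠ 0}) :
    ∃ P g : C3 → ℂ, Differentiable ℂ P ∧ Differentiable ℂ g ∧ ∀ x : C3, x 0 ≠ 0 →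
      f x = P x + tau x 0 * g (![tau x 0, (tau x 0) ^ 2 * tau x 1, tau x 2]) := by
  obtain ⟨P, g, hP, hg, h⟩ := exists_laurent hf
  refine ⟨P, g, hP, hg, fun x hx => ?_⟩
  rw [h x hx]
  congr 3
  funext i
  fin_cases i <;> simp
  field_simp

theorem differentiable_vec {E : Type*} [NormedAddCommGroup E] [NormedSpace ℂ E] {a b c : E → ℂ}
    (ha : Differentiable ℂ a) (hb : Differentiable ℂ b) (hc : Differentiable ℂ c) :
    Differentiable ℂ fun x => (![a x, b x, c x] : C3) := by
  rw [differentiable_pi]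
  intro i
  fin_cases i
  exacts [ha, hb, hc]

theorem differentiable_slice {h : C3 → ℂ} (hh : Differentiable ℂ h) :
    Differentiable ℂ fun t : ℂ => h ![0, 0, t] :=
  hh.comp (differentiable_vec (by fun_prop) (by fun_prop) (by fun_prop))

theorem update_one_zero (x : C3) : Function.update x 1 0 = ![x 0, 0, x 2] := by
  funext i
  fin_cases i <;> simp

theorem update_zero_zero (x : C3) : Function.update x 0 0 = ![0, x 1, x 2] := by
  funext i
  fin_cases i <;> simp

theorem exists_div0 {f : C3 → ℂ} (hf : Differentiable ℂ f) :
    ∃ q : C3 → ℂ, Differentiable ℂ q ∧ ∀ x, f x = f ![0, x 1, x 2] + x 0 * q x := by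
  obtain ⟨q, hq, h⟩ := exists_division 0 hf
  exact ⟨q, hq, fun x => by rw [h x, update_zero_zero]⟩

theorem exists_div1 {f : C3 → ℂ} (hf : Differentiable ℂ f) :
    ∃ q : C3 → ℂ, Differentiable ℂ q ∧ ∀ x, f x = f ![x 0, 0, x 2] + x 1 * q x := by
  obtain ⟨q, hq, h⟩ := exists_division 1 hf
  exact ⟨q, hq, fun x => by rw [h x, update_one_zero]⟩

/-- Functions on `x 0 ≠ 0` modulo entire functions of `x` and of `tau x`. -/
theorem exists_decomp_zero {f : C3 → ℂ} (hf : DifferentiableOn ℂ f {x | x 0 ≠ 0}) :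
    ∃ P G : C3 → ℂ, Differentiable ℂ P ∧ Differentiable ℂ G ∧ ∀ x : C3, x 0 ≠ 0 →
      f x = P x + G (tau x) := by
  obtain ⟨P, g, hP, hg, h⟩ := exists_add_comp_tau hf
  refine ⟨P, fun y => y 0 * g ![y 0, (y 0) ^ 2 * y 1, y 2], hP, ?_, h⟩
  exact Differentiable.fun_mul (by fun_prop)
    (hg.comp (differentiable_vec (by fun_prop) (by fun_prop) (by fun_prop)))

/-- Functions on `x 0 ≠ 0` modulo entire functions of `x` and `(x 0)⁻²` times entire functions
of `tau x`. -/
theorem exists_decomp_two {f : C3 → ℂ} (hf : DifferentiableOn ℂ f {x | x 0 ≠ 0}) :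
    ∃ (P G : C3 → ℂ) (h : ℂ → ℂ), Differentiable ℂ P ∧ Differentiable ℂ G ∧ Differentiable ℂ h ∧
      ∀ x : C3, x 0 ≠ 0 → f x = P x + (x 0)⁻¹ * h (x 2) + (x 0 ^ 2)⁻¹ * G (tau x) := by
  obtain ⟨P, g, hP, hg, h⟩ := exists_add_comp_tau hf
  obtain ⟨a, ha, hga⟩ := exists_div1 hg
  obtain ⟨b, hb, hgb⟩ := exists_div0 hg
  -- The negative part is `ξ g(ξ, ξ²v₁, v₂)`. With `g = g(0,0,·) + ξ b + u₁ a` and `u₁ = ξ²v₁`,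
  -- every term but `ξ g(0,0,v₂)` is divisible by `ξ²`.
  refine ⟨P, fun y => y 0 * y 1 * a ![y 0, (y 0) ^ 2 * y 1, y 2] + b ![y 0, 0, y 2],
    fun t => g ![0, 0, t], hP, ?_, differentiable_slice hg, fun x hx => ?_⟩
  · have h1 : Differentiable ℂ fun y : C3 => a ![y 0, (y 0) ^ 2 * y 1, y 2] :=
      ha.comp (differentiable_vec (by fun_prop) (by fun_prop) (by fun_prop))
    have h2 : Differentiable ℂ fun y : C3 => b ![y 0, 0, y 2] :=
      hb.comp (differentiable_vec (by fun_prop) (by fun_prop) (by fun_prop))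
    exact (Differentiable.fun_mul (by fun_prop) h1).fun_add h2
  · have h1 := hga ![tau x 0, (tau x 0) ^ 2 * tau x 1, tau x 2]
    have h2 := hgb ![tau x 0, 0, tau x 2]
    simp only [Matrix.cons_val] at h1 h2
    rw [h x hx, h1, h2]
    simp only [tau_zero, tau_one, tau_two]
    field_simp
    ring

/-- Functions on `x 0 ≠ 0` modulo entire functions of `x` and `(x 0)⁻⁴` times entire functions
of `tau x`. -/
theorem exists_decomp_four {f : C3 → ℂ} (hf : DifferentiableOn ℂ f {x | x 0 ≠ 0}) :
    ∃ (P G : C3 → ℂ) (h : Fin 4 → ℂ → ℂ), Differentiable ℂ P ∧ Differentiable ℂ G ∧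
      (∀ i, Differentiable ℂ (h i)) ∧
      ∀ x : C3, x 0 ≠ 0 → f x = P x + ((x 0)⁻¹ * x 1 * h 0 (x 2) + (x 0)⁻¹ * h 1 (x 2) +
        (x 0 ^ 2)⁻¹ * h 2 (x 2) + (x 0 ^ 3)⁻¹ * h 3 (x 2)) + (x 0 ^ 4)⁻¹ * G (tau x) := by
  obtain ⟨P, g, hP, hg, h⟩ := exists_add_comp_tau hf
  obtain ⟨a, ha, hga⟩ := exists_div1 hg
  obtain ⟨a', ha', haa⟩ := exists_div1 ha
  obtain ⟨a'', ha'', haa'⟩ := exists_div0 ha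
  obtain ⟨b, hb, hgb⟩ := exists_div0 hg
  obtain ⟨b', hb', hbb⟩ := exists_div0 hb
  obtain ⟨b'', hb'', hbb'⟩ := exists_div0 hb'
  -- In `ξ g(ξ, ξ²v₁, v₂)` the terms not divisible by `ξ⁴` are `ξ`, `ξ²`, `ξ³` (with no `u₁`) and `ξ
  -- u₁ = ξ³v₁`. They are isolated by dividing three times by `ξ` along `u₁ = 0`, and in the
  -- coefficient `a` of `u₁` once by each of `u₁` and `ξ`.
  refine ⟨P, fun y => y 0 * y 1 ^ 2 * a' ![y 0, (y 0) ^ 2 * y 1, y 2] +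
    y 1 * a'' ![y 0, 0, y 2] + b'' ![y 0, 0, y 2],
    ![fun t => a ![0, 0, t], fun t => g ![0, 0, t], fun t => b ![0, 0, t],
      fun t => b' ![0, 0, t]], hP, ?_, ?_, fun x hx => ?_⟩
  · have h1 : Differentiable ℂ fun y : C3 => a' ![y 0, (y 0) ^ 2 * y 1, y 2] :=
      ha'.comp (differentiable_vec (by fun_prop) (by fun_prop) (by fun_prop))
    have h2 : Differentiable ℂ fun y : C3 => b'' ![y 0, 0, y 2] :=
      hb''.comp (differentiable_vec (by fun_prop) (by fun_prop) (by fun_prop))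
    have h3 : Differentiable ℂ fun y : C3 => a'' ![y 0, 0, y 2] :=
      ha''.comp (differentiable_vec (by fun_prop) (by fun_prop) (by fun_prop))
    exact ((Differentiable.fun_mul (by fun_prop) h1).fun_add
      (Differentiable.fun_mul (by fun_prop) h3)).fun_add h2
  · intro i
    fin_cases i
    exacts [differentiable_slice ha, differentiable_slice hg, differentiable_slice hb,
      differentiable_slice hb']
  · have h1 := hga ![tau x 0, (tau x 0) ^ 2 * tau x 1, tau x 2]
    have h2 := hgb ![tau x 0, 0, tau x 2]
    have h3 := hbb ![tau x 0, 0, tau x 2]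
    have h4 := hbb' ![tau x 0, 0, tau x 2]
    have h5 := haa ![tau x 0, (tau x 0) ^ 2 * tau x 1, tau x 2]
    have h6 := haa' ![tau x 0, 0, tau x 2]
    simp only [Matrix.cons_val] at h1 h2 h3 h4 h5 h6 ⊢
    rw [h x hx, h1, h2, h3, h4, h5, h6]
    simp only [tau_zero, tau_one, tau_two]
    field_simp
    ring

/-! ### Holomorphic sections in the frames of the two charts -/

theorem chartAt_ptU (x : C3) :
    chartAt C3 (ptU x) = w2Core.openPartialHomeomorph chartU (Or.inl rfl) := by
  have : w2Core.chartAt (ptU x) = chartU := if_pos (Set.mem_range_self x)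
  change w2Core.openPartialHomeomorph (w2Core.chartAt (ptU x)) _ = _
  congr 1

/-- The preferred chart is `chartU` wherever possible, so `chartV` is preferred only off `U`, that
is where `ξ = 0`. Thus `ptU 0` and `ptV 0` serve as base points for the trivializations over `U` and
`V`. -/
theorem chartAt_ptV {y : C3} (hy : y 0 = 0) :
    chartAt C3 (ptV y) = w2Core.openPartialHomeomorph chartV (Or.inr rfl) := by
  have : w2Core.chartAt (ptV y) = chartV := if_neg fun h => ptV_mem_range_ptU.1 h hy
  change w2Core.openPartialHomeomorph (w2Core.chartAt (ptV y)) _ = _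
  congr 1

theorem mdifferentiable_ptU : MDifferentiable 𝓘(ℂ, C3) 𝓘(ℂ, C3) ptU := by
  have h : MDifferentiableOn 𝓘(ℂ, C3) 𝓘(ℂ, C3) (extChartAt 𝓘(ℂ, C3) (ptU 0)).symm
      (extChartAt 𝓘(ℂ, C3) (ptU 0)).target :=
    (contMDiffOn_extChartAt_symm (n := 1) (ptU 0)).mdifferentiableOn one_ne_zero
  rw [← mdifferentiableOn_univ]
  simp only [extChartAt, chartAt_ptU, mfld_simps] at h
  exact h

theorem mdifferentiable_ptV : MDifferentiable 𝓘(ℂ, C3) 𝓘(ℂ, C3) ptV := by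
  have h : MDifferentiableOn 𝓘(ℂ, C3) 𝓘(ℂ, C3) (extChartAt 𝓘(ℂ, C3) (ptV 0)).symm
      (extChartAt 𝓘(ℂ, C3) (ptV 0)).target :=
    (contMDiffOn_extChartAt_symm (n := 1) (ptV 0)).mdifferentiableOn one_ne_zero
  rw [← mdifferentiableOn_univ]
  simp only [extChartAt, chartAt_ptV (y := 0) rfl, mfld_simps] at h
  exact h

theorem mdifferentiableOn_coordU : MDifferentiableOn 𝓘(ℂ, C3) 𝓘(ℂ, C3) coordU U := fun p hp => by
  have h := mdifferentiableAt_extChartAt (I := 𝓘(ℂ, C3)) (x := ptU 0) (y := p)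
  rw [chartAt_ptU] at h
  have h' := h hp
  simp only [extChartAt, chartAt_ptU, mfld_simps] at h'
  exact MDifferentiableAt.mdifferentiableWithinAt h'

theorem mdifferentiableOn_coordV : MDifferentiableOn 𝓘(ℂ, C3) 𝓘(ℂ, C3) coordV V := fun p hp => by
  have h := mdifferentiableAt_extChartAt (I := 𝓘(ℂ, C3)) (x := ptV 0) (y := p)
  rw [chartAt_ptV (y := 0) rfl] at h
  have h' := h hp
  simp only [extChartAt, chartAt_ptV (y := 0) rfl, mfld_simps] at h'
  exact MDifferentiableAt.mdifferentiableWithinAt h'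

theorem ptU_mem_U (x : C3) : ptU x ∈ U := Set.mem_range_self x

theorem ptV_mem_V (x : C3) : ptV x ∈ V := Set.mem_range_self x

theorem ptU_mem_inf {x : C3} : ptU x ∈ U ⊓ V ↔ x 0 ≠ 0 :=
  ⟨fun h => ptU_mem_range_ptV.1 h.2, fun h => ⟨ptU_mem_U x, ptU_mem_range_ptV.2 h⟩⟩

theorem ptU_coordU {p : W2} (hp : p ∈ U) : ptU (coordU p) = p := chartU.left_inv hp

theorem ptV_coordV {p : W2} (hp : p ∈ V) : ptV (coordV p) = p := chartV.left_inv hp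

variable {F : Type*} [NormedAddCommGroup F] [NormedSpace ℂ F]

theorem mdifferentiableOn_iff_U {O : TopologicalSpace.Opens W2} (hO : O ≤ U) {f : W2 → F} :
    MDifferentiableOn 𝓘(ℂ, C3) 𝓘(ℂ, F) f O ↔
      DifferentiableOn ℂ (fun x => f (ptU x)) (ptU ⁻¹' O) := by
  rw [← mdifferentiableOn_iff_differentiableOn]
  refine ⟨fun h => h.comp mdifferentiable_ptU.mdifferentiableOn subset_rfl, fun h => ?_⟩
  refine (MDifferentiableOn.comp (u := ptU ⁻¹' O) h (mdifferentiableOn_coordU.mono hO)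
    fun p hp => ?_).congr fun p hp => ?_
  · simpa [ptU_coordU (hO hp)] using hp
  · simp [ptU_coordU (hO hp)]

theorem mdifferentiableOn_iff_V {f : W2 → F} :
    MDifferentiableOn 𝓘(ℂ, C3) 𝓘(ℂ, F) f V ↔ Differentiable ℂ fun x => f (ptV x) := by
  rw [← differentiableOn_univ, ← mdifferentiableOn_iff_differentiableOn]
  refine ⟨fun h => h.comp mdifferentiable_ptV.mdifferentiableOn fun x _ => ptV_mem_V x,
    fun h => ?_⟩
  refine (MDifferentiableOn.comp (u := Set.univ) h mdifferentiableOn_coordV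
    fun p _ => Set.mem_univ _).congr fun p hp => ?_
  simp [ptV_coordV hp]

/-- The coordinates of an endomorphism with respect to the chart around a point. -/
abbrev endCoord (p₀ p : W2) (φ : T p →L[ℂ] T p) : C3 →L[ℂ] C3 :=
  ContinuousLinearMap.inCoordinates C3 T C3 T p₀ p p₀ p φ

theorem isHolSection_iff {O : TopologicalSpace.Opens W2} (p₀ : W2)
    (hO : (O : Set W2) ⊆ (chartAt C3 p₀).source) (s : ∀ p : O, EndT p) :
    IsHolSection O s ↔ MDifferentiableOn 𝓘(ℂ, C3) 𝓘(ℂ, C3 →L[ℂ] C3)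
      (fun p => endCoord p₀ p (extend s p)) (O : Set W2) :=
  Trivialization.mdifferentiableOn_section_iff
    (trivializationAt (C3 →L[ℂ] C3) EndT p₀) O.isOpen fun _ hp => ⟨hO hp, hO hp⟩

theorem chartAt_source_U : (chartAt C3 (ptU 0)).source = U := by
  rw [chartAt_ptU]; rfl

theorem chartAt_source_V : (chartAt C3 (ptV 0)).source = V := by
  rw [chartAt_ptV (y := 0) rfl]; rfl

/-- All points of `U` have the same preferred chart, so the fibre over such a point, which is `C3
→L[ℂ] C3` by definition, already consists of matrices in the frame of `U`. -/
theorem endCoord_U {p : W2} (hp : p ∈ U) (φ : EndT p) : endCoord (ptU 0) p φ = φ := by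
  have hp' : p ∈ (chartAt C3 (ptU 0)).source := by rw [chartAt_source_U]; exact hp
  have ha : achart C3 p = achart C3 (ptU 0) := Subtype.ext (by
    rw [coe_achart, coe_achart, ← ptU_coordU hp, chartAt_ptU, chartAt_ptU])
  have hid : ∀ v, (tangentBundleCore 𝓘(ℂ, C3) W2).coordChange (achart C3 (ptU 0))
      (achart C3 (ptU 0)) p v = v :=
    fun v => (tangentBundleCore 𝓘(ℂ, C3) W2).coordChange_self _ _ hp' v
  have h1 := TangentBundle.continuousLinearMapAt_trivializationAt_eq_core (I := 𝓘(ℂ, C3)) hp'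
  have h2 := TangentBundle.symmL_trivializationAt_eq_core (I := 𝓘(ℂ, C3)) hp'
  rw [ha] at h1 h2
  unfold endCoord ContinuousLinearMap.inCoordinates
  rw [h1, h2]
  ext1 v
  exact (hid _).trans (congrArg φ (hid v))

/-- The matrix function of a section in the frame of `U`, as an endomorphism of `ℂ³`. -/
def frameU {O : TopologicalSpace.Opens W2} (s : ∀ p : O, EndT p) (x : C3) : C3 →L[ℂ] C3 :=
  extend s (ptU x)

theorem isHolSection_iff_U {O : TopologicalSpace.Opens W2} (hO : O ≤ U) (s : ∀ p : O, EndT p) :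
    IsHolSection O s ↔
      DifferentiableOn ℂ (frameU s) (ptU ⁻¹' O) := by
  rw [isHolSection_iff (ptU 0) (by rw [chartAt_source_U]; exact hO), mdifferentiableOn_iff_U hO]
  have h : ∀ x, endCoord (ptU 0) (ptU x) (extend s (ptU x)) = frameU s x :=
    fun x => endCoord_U (ptU_mem_U x) _
  simp only [h]

theorem isHolSection_iff_V (s : ∀ p : V, EndT p) :
    IsHolSection V s ↔ Differentiable ℂ fun y => endCoord (ptV 0) (ptV y) (extend s (ptV y)) := by
  rw [isHolSection_iff (ptV 0) chartAt_source_V.ge, mdifferentiableOn_iff_V]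

/-! ### The Jacobian and the coboundary condition -/

/-- The Jacobian matrix of the change of coordinates. -/
def jacMatrix (x : C3) : Fin 3 → Fin 3 → ℂ :=
  ![![-(x 0 ^ 2)⁻¹, 0, 0], ![2 * x 0 * x 1, x 0 ^ 2, 0], ![0, 0, 1]]

/-- The endomorphism of `ℂ³` with a given matrix, linearly in the matrix. -/
def matCLM : (Fin 3 → Fin 3 → ℂ) →L[ℂ] (C3 →L[ℂ] C3) :=
  LinearMap.toContinuousLinearMap
    ((LinearMap.toContinuousLinearMap : (C3 →ₗ[ℂ] C3) ≃ₗ[ℂ] (C3 →L[ℂ] C3)).toLinearMap.comp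
      (Matrix.toLin' : Matrix (Fin 3) (Fin 3) ℂ ≃ₗ[ℂ] (C3 →ₗ[ℂ] C3)).toLinearMap)

theorem matCLM_apply (M : Fin 3 → Fin 3 → ℂ) :
    matCLM M = LinearMap.toContinuousLinearMap (Matrix.toLin' (Matrix.of M)) := rfl

theorem matCLM_apply_apply (M : Fin 3 → Fin 3 → ℂ) (v : C3) (i : Fin 3) :
    matCLM M v i = M i 0 * v 0 + M i 1 * v 1 + M i 2 * v 2 := by
  simp [matCLM_apply, Matrix.mulVec, dotProduct, Fin.sum_univ_three]

theorem hasFDerivAt_tau {x : C3} (hx : x 0 ≠ 0) : HasFDerivAt tau (matCLM (jacMatrix x)) x := by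
  rw [hasFDerivAt_pi']
  have hc : ∀ i : Fin 3, HasFDerivAt (fun y : C3 => y i) (ContinuousLinearMap.proj (R := ℂ) i) x :=
    fun i => hasFDerivAt_apply i x
  intro i
  fin_cases i
  · refine ((hasDerivAt_inv hx).comp_hasFDerivAt x (hc 0)).congr_fderiv ?_
    ext v
    simp [matCLM_apply_apply, jacMatrix]
  · refine (((hc 0).pow 2).mul (hc 1)).congr_fderiv ?_
    ext v
    simp [matCLM_apply_apply, jacMatrix]
    ring
  · refine (hc 2).congr_fderiv ?_
    ext v
    simp [matCLM_apply_apply, jacMatrix]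

/-- The matrix in the frame of `V` of an endomorphism. -/
theorem endCoord_V {x : C3} (hx : x 0 ≠ 0) (φ : EndT (ptU x)) :
    (endCoord (ptV 0) (ptU x) φ).comp (matCLM (jacMatrix x)) =
      (matCLM (jacMatrix x)).comp (φ : C3 →L[ℂ] C3) := by
  have hp : ptU x ∈ (chartAt C3 (ptV 0)).source := by
    rw [chartAt_source_V]; exact ptU_mem_range_ptV.2 hx
  have h1 := TangentBundle.continuousLinearMapAt_trivializationAt_eq_core (I := 𝓘(ℂ, C3)) hp
  have h2 := TangentBundle.symmL_trivializationAt_eq_core (I := 𝓘(ℂ, C3)) hp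
  have h3 : (tangentBundleCore 𝓘(ℂ, C3) W2).coordChange (achart C3 (ptU x)) (achart C3 (ptV 0))
      (ptU x) = matCLM (jacMatrix x) := by
    rw [tangentBundleCore_coordChange_achart]
    simp only [extChartAt, chartAt_ptU, chartAt_ptV (y := 0) rfl, mfld_simps, fderivWithin_univ]
    exact (hasFDerivAt_tau hx).fderiv
  have h4 : ∀ v, (tangentBundleCore 𝓘(ℂ, C3) W2).coordChange (achart C3 (ptV 0))
      (achart C3 (ptU x)) (ptU x) (matCLM (jacMatrix x) v) = v := by
    intro v
    rw [← h3, (tangentBundleCore 𝓘(ℂ, C3) W2).coordChange_comp _ _ _ _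
      ⟨⟨mem_chart_source C3 (ptU x), hp⟩, mem_chart_source C3 (ptU x)⟩,
      (tangentBundleCore 𝓘(ℂ, C3) W2).coordChange_self _ _ (mem_chart_source C3 (ptU x))]
  unfold endCoord ContinuousLinearMap.inCoordinates
  rw [h1, h2, h3]
  ext1 v
  exact congrArg (fun w => matCLM (jacMatrix x) (φ w)) (h4 v)

/-- Every matrix in the frame of `V` comes from an endomorphism. -/
theorem exists_endCoord {p : W2} (hp : p ∈ V) (B : C3 →L[ℂ] C3) :
    ∃ φ : EndT p, endCoord (ptV 0) p φ = B := by
  have hp' : p ∈ (trivializationAt C3 T (ptV 0)).baseSet := by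
    rw [TangentBundle.trivializationAt_baseSet, chartAt_source_V]; exact hp
  refine ⟨((trivializationAt C3 T (ptV 0)).symmL ℂ p).comp
    (B.comp ((trivializationAt C3 T (ptV 0)).continuousLinearMapAt ℂ p)), ?_⟩
  unfold endCoord ContinuousLinearMap.inCoordinates
  ext1 v
  simp only [ContinuousLinearMap.comp_apply]
  rw [Trivialization.continuousLinearMapAt_symmL _ hp',
    Trivialization.continuousLinearMapAt_symmL _ hp']

/-- The matrix function in the frame of `U` of a section over `U ∩ V`. -/
def coc (σ : sections (U ⊓ V)) (x : C3) : C3 →L[ℂ] C3 := frameU σ.1 x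

theorem extend_of_mem {O : TopologicalSpace.Opens W2} (s : ∀ p : O, EndT p) {p : W2} (hp : p ∈ O) :
    extend s p = s ⟨p, hp⟩ := dif_pos hp

theorem preimage_inf : ptU ⁻¹' ((U ⊓ V : TopologicalSpace.Opens W2) : Set W2) = {x | x 0 ≠ 0} :=
  Set.ext fun _ => ptU_mem_inf

theorem differentiableOn_coc (σ : sections (U ⊓ V)) :
    DifferentiableOn ℂ (coc σ) {x | x 0 ≠ 0} := by
  have := (isHolSection_iff_U inf_le_left σ.1).1 σ.2
  rwa [preimage_inf] at this

/-- The endomorphism of `T_p W₂` with the given coordinates in the preferred chart at `p`. -/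
def endOf (p : W2) (φ : C3 →L[ℂ] C3) : EndT p := φ

theorem isHolSection_inf {f : C3 → C3 →L[ℂ] C3} (hf : DifferentiableOn ℂ f {x | x 0 ≠ 0}) :
    IsHolSection (U ⊓ V) fun p => endOf p (f (coordU p)) := by
  rw [isHolSection_iff_U inf_le_left, preimage_inf]
  refine hf.congr fun x hx => ?_
  exact extend_of_mem _ (ptU_mem_inf.2 hx)

/-- The section over `U ∩ V` with a given matrix function in the frame of `U`. -/
def ofCoc (f : C3 → C3 →L[ℂ] C3) (hf : DifferentiableOn ℂ f {x | x 0 ≠ 0}) : sections (U ⊓ V) :=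
  ⟨fun p => endOf p (f (coordU p)), isHolSection_inf hf⟩

theorem coc_ofCoc {f : C3 → C3 →L[ℂ] C3} (hf : DifferentiableOn ℂ f {x | x 0 ≠ 0}) {x : C3}
    (hx : x 0 ≠ 0) : coc (ofCoc f hf) x = f x :=
  extend_of_mem _ (ptU_mem_inf.2 hx)

theorem coc_sub (σ σ' : sections (U ⊓ V)) {x : C3} (hx : x 0 ≠ 0) :
    coc (σ - σ') x = coc σ x - coc σ' x := by
  have := ptU_mem_inf.2 hx
  simp only [coc, frameU, extend_of_mem _ this]
  rfl

theorem exists_section_U {f : C3 → C3 →L[ℂ] C3} (hf : Differentiable ℂ f) :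
    ∃ a : sections U, ∀ x, frameU a.1 x = f x := by
  have h : ∀ x, frameU (O := U) (fun p => endOf p (f (coordU p))) x = f x :=
    fun x => extend_of_mem _ (ptU_mem_U x)
  refine ⟨⟨fun p => endOf p (f (coordU p)), (isHolSection_iff_U le_rfl _).2 ?_⟩, h⟩
  exact hf.differentiableOn.congr fun x _ => h x

theorem exists_section_V {B : C3 → C3 →L[ℂ] C3} (hB : Differentiable ℂ B) :
    ∃ b : sections V, ∀ y, endCoord (ptV 0) (ptV y) (extend b.1 (ptV y)) = B y := by
  choose s hs using fun p : V => exists_endCoord p.2 (B (coordV p))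
  have h : ∀ y, endCoord (ptV 0) (ptV y) (extend s (ptV y)) = B y := fun y => by
    rw [extend_of_mem _ (ptV_mem_V y)]
    exact hs ⟨ptV y, ptV_mem_V y⟩
  refine ⟨⟨s, (isHolSection_iff_V s).2 ?_⟩, h⟩
  simpa only [h] using hB

theorem coc_cechD (a : sections U) (b : sections V) {x : C3} (hx : x 0 ≠ 0) :
    coc (cechD (a, b)) x =
      frameU b.1 x - frameU a.1 x := by
  have h := ptU_mem_inf.2 hx
  rw [coc, frameU, frameU, frameU, extend_of_mem _ h, extend_of_mem _ h.1, extend_of_mem _ h.2]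
  rfl

/-- The Jacobian is lower triangular with diagonal `-z⁻², z², 1`. -/
theorem matCLM_jac_injective {x : C3} (hx : x 0 ≠ 0) {X Y : C3 →L[ℂ] C3}
    (h : (matCLM (jacMatrix x)).comp X = (matCLM (jacMatrix x)).comp Y) : X = Y := by
  ext1 v
  have h' := DFunLike.congr_fun h v
  simp only [ContinuousLinearMap.comp_apply] at h'
  generalize X v = p at h'
  generalize Y v = q at h'
  have h0 := congrFun h' 0
  have h1 := congrFun h' 1
  have h2 := congrFun h' 2
  simp [matCLM_apply_apply, jacMatrix, hx] at h0 h1 h2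
  funext i
  fin_cases i
  · exact h0
  · simpa [h0, hx] using h1
  · exact h2

/-- Coboundaries in terms of matrix functions. -/
theorem mem_range_cechD_iff (σ : sections (U ⊓ V)) :
    σ ∈ LinearMap.range cechD ↔ ∃ A B : C3 → C3 →L[ℂ] C3, Differentiable ℂ A ∧ Differentiable ℂ B ∧
      ∀ x, x 0 ≠ 0 → (matCLM (jacMatrix x)).comp (coc σ x - A x) =
        (B (tau x)).comp (matCLM (jacMatrix x)) := by
  constructor
  · rintro ⟨⟨a, b⟩, rfl⟩
    -- The sign comes from `cechD`, which subtracts the section over `U`.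
    refine ⟨fun x => -frameU a.1 x,
      fun y => endCoord (ptV 0) (ptV y) (extend b.1 (ptV y)), ?_, (isHolSection_iff_V _).1 b.2, ?_⟩
    · have := (isHolSection_iff_U le_rfl a.1).1 a.2
      have hU : ptU ⁻¹' (U : Set W2) = Set.univ := Set.eq_univ_of_forall ptU_mem_U
      rw [hU, differentiableOn_univ] at this
      exact this.neg
    · intro x hx
      change _ = (endCoord (ptV 0) (ptV (tau x)) (extend b.1 (ptV (tau x)))).comp _
      rw [← ptU_eq_ptV hx, endCoord_V hx, coc_cechD a b hx]
      rw [sub_neg_eq_add, sub_add_cancel]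
      rfl
  · rintro ⟨A, B, hA, hB, h⟩
    obtain ⟨a, ha⟩ := exists_section_U (f := fun x => -A x) hA.neg
    obtain ⟨b, hb⟩ := exists_section_V hB
    refine ⟨(a, b), ?_⟩
    ext p
    obtain ⟨p, hp⟩ := p
    obtain ⟨x, rfl⟩ := hp.1
    have hx := ptU_mem_inf.1 hp
    have h1 := hb (tau x)
    rw [← ptU_eq_ptV hx] at h1
    have h2 := endCoord_V hx (extend b.1 (ptU x))
    rw [h1, ← h x hx] at h2
    have h3 : coc σ x - A x = frameU b.1 x := matCLM_jac_injective hx h2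
    have h4 := coc_cechD a b hx
    rw [ha, ← h3] at h4
    have h5 : coc (cechD (a, b)) x = coc σ x := by rw [h4]; abel
    unfold coc frameU at h5
    rw [extend_of_mem _ hp, extend_of_mem _ hp] at h5
    exact DFunLike.congr_fun h5 _

/-! ### The generating cocycles in the frame of `U` -/

theorem mfderiv_coordU (x : C3) : (mfderiv 𝓘(ℂ, C3) 𝓘(ℂ, C3) coordU (ptU x) : C3 →L[ℂ] C3) =
    ContinuousLinearMap.id ℂ C3 := by
  have h := (mdifferentiableOn_coordU _ (ptU_mem_U x)).mdifferentiableAt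
    (U.isOpen.mem_nhds (ptU_mem_U x))
  refine h.mfderiv.trans ?_
  simp only [writtenInExtChartAt, extChartAt, chartAt_ptU, mfld_simps, fderivWithin_univ]
  exact fderiv_id

theorem mfderiv_ptU (x : C3) : (mfderiv 𝓘(ℂ, C3) 𝓘(ℂ, C3) ptU x : C3 →L[ℂ] C3) =
    ContinuousLinearMap.id ℂ C3 := by
  refine (mdifferentiable_ptU x).mfderiv.trans ?_
  simp only [writtenInExtChartAt, extChartAt, chartAt_ptU, mfld_simps, fderivWithin_univ]
  exact fderiv_id

theorem ofMatrixU_ptU (x : C3) (M : Matrix (Fin 3) (Fin 3) ℂ) :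
    ofMatrixU (ptU x) M = endOf (ptU x) (matCLM M) := by
  unfold ofMatrixU
  rw [mfderiv_coordU, coordU_ptU, mfderiv_ptU]
  rfl

/-- The endomorphism of `ℂ³` given by a generating matrix. -/
def genCLM (m : Fin 6) (k : ℕ) (x : C3) : C3 →L[ℂ] C3 := matCLM fun i j => genMatrix m k x i j

theorem genCLM_apply (m : Fin 6) (k : ℕ) (x v : C3) (i : Fin 3) :
    genCLM m k x v i = genMatrix m k x i 0 * v 0 + genMatrix m k x i 1 * v 1 +
      genMatrix m k x i 2 * v 2 := matCLM_apply_apply _ v i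

theorem gen_eq (i : Fin 6 × ℕ) (p : (U ⊓ V : TopologicalSpace.Opens W2)) :
    gen i p = endOf p (genCLM i.1 i.2 (coordU p)) := by
  obtain ⟨p, hp⟩ := p
  obtain ⟨x, rfl⟩ := hp.1
  exact ofMatrixU_ptU x _

theorem differentiableOn_single {E : Type*} [NormedAddCommGroup E] [NormedSpace ℂ E] {s : Set E}
    {f : E → ℂ} (hf : DifferentiableOn ℂ f s) (i j : Fin 3) :
    DifferentiableOn ℂ (fun x => matCLM (Matrix.single i j (f x))) s := by
  have h : ∀ x, matCLM (Matrix.single i j (f x)) =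
      f x • matCLM (Matrix.single i j (1 : ℂ) : Matrix (Fin 3) (Fin 3) ℂ) := by
    intro x
    rw [← mul_one (f x), ← smul_eq_mul, ← Matrix.smul_single]
    exact (map_smul matCLM (f x) _).trans (by rw [smul_eq_mul, mul_one])
  simp only [h]
  exact hf.smul_const _

theorem differentiableOn_genMatrix (m : Fin 6) (k : ℕ) :
    DifferentiableOn ℂ (fun x => genCLM m k x) {x | x 0 ≠ 0} := by
  have h0 : DifferentiableOn ℂ (fun x : C3 => (x 0)⁻¹) {x | x 0 ≠ 0} :=
    DifferentiableOn.inv (by fun_prop) fun x hx => hx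
  have h2 : DifferentiableOn ℂ (fun x : C3 => (x 0 ^ 2)⁻¹) {x | x 0 ≠ 0} :=
    DifferentiableOn.inv (by fun_prop) fun x hx => pow_ne_zero 2 hx
  have h3 : DifferentiableOn ℂ (fun x : C3 => (x 0 ^ 3)⁻¹) {x | x 0 ≠ 0} :=
    DifferentiableOn.inv (by fun_prop) fun x hx => pow_ne_zero 3 hx
  fin_cases m <;> exact differentiableOn_single (by fun_prop) _ _

theorem gen_mem (i : Fin 6 × ℕ) : gen i ∈ sections (U ⊓ V) := by
  have h : gen i = fun p : (U ⊓ V : TopologicalSpace.Opens W2) =>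
      endOf p (genCLM i.1 i.2 (coordU p)) := funext (gen_eq i)
  rw [h]
  exact isHolSection_inf (f := fun x => genCLM i.1 i.2 x)
    (differentiableOn_genMatrix i.1 i.2)

/-- Dependence on `k` is only through `u₂ᵏ`, so series of generators are power series in `u₂` times
the six matrices with `k = 0`. -/
theorem genCLM_eq_smul (m : Fin 6) (k : ℕ) (x : C3) :
    genCLM m k x = x 2 ^ k • genCLM m 0 x := by
  have h : genMatrix m k x = x 2 ^ k • genMatrix m 0 x := by
    fin_cases m <;> simp [genMatrix, mul_comm]
  refine Eq.trans (congrArg matCLM ?_) (map_smul matCLM _ _)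
  funext i j
  rw [h]
  rfl

/-! ### The normal form of a cocycle -/

theorem differentiable_matCLM {E : Type*} [NormedAddCommGroup E] [NormedSpace ℂ E]
    {M : E → Fin 3 → Fin 3 → ℂ} (h : ∀ i j, Differentiable ℂ (fun x => M x i j)) :
    Differentiable ℂ (fun x => matCLM (M x)) :=
  matCLM.differentiable.comp (differentiable_pi.2 fun i => differentiable_pi.2 fun j => h i j)

/-- The matrix entries of an endomorphism of `ℂ³`. -/
def entry (φ : C3 →L[ℂ] C3) (i j : Fin 3) : ℂ := φ (Pi.single j 1) i

theorem matCLM_entry (φ : C3 →L[ℂ] C3) : matCLM (entry φ) = φ := by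
  ext v i
  conv_rhs => rw [← Finset.univ_sum_single v, map_sum]
  rw [matCLM_apply_apply]
  have h : ∀ j, Pi.single (M := fun _ : Fin 3 => ℂ) j (v j) = v j • Pi.single j 1 := fun j => by
    rw [← Pi.single_smul, smul_eq_mul, mul_one]
  simp only [Fin.sum_univ_three, h, map_smul, Pi.add_apply, Pi.smul_apply, smul_eq_mul, entry]
  ring

theorem differentiableOn_entry (σ : sections (U ⊓ V)) (i j : Fin 3) :
    DifferentiableOn ℂ (fun x => entry (coc σ x) i j) {x | x 0 ≠ 0} := by
  have h1 := (differentiableOn_coc σ).clm_apply (differentiableOn_const (Pi.single j (1 : ℂ)))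
  exact differentiableOn_pi.1 h1 i

/-- The matrix in the frame of `V` used to remove the part of a cocycle that extends to `V`. -/
def cobV (g : Fin 3 → Fin 3 → ℂ) (y : C3) : Fin 3 → Fin 3 → ℂ :=
  ![![g 0 0 - 2 * y 0 ^ 3 * y 1 * g 0 1, -(y 0 ^ 4 * g 0 1), -(y 0 ^ 2 * g 0 2)],
    ![-g 1 0, g 1 1 + 2 * y 0 ^ 3 * y 1 * g 0 1, g 1 2],
    ![-g 2 0, y 0 ^ 2 * g 2 1, g 2 2]]

/-- The matrix `cobV` in the frame of `U`. -/
def cobU (g : Fin 3 → Fin 3 → ℂ) (x : C3) : Fin 3 → Fin 3 → ℂ :=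
  ![![g 0 0, g 0 1, g 0 2],
    ![(x 0 ^ 4)⁻¹ * g 1 0 + 2 * (x 0)⁻¹ * x 1 * (g 1 1 - g 0 0) +
        4 * (x 0 ^ 2)⁻¹ * x 1 ^ 2 * g 0 1, g 1 1,
      (x 0 ^ 2)⁻¹ * g 1 2 - 2 * (x 0)⁻¹ * x 1 * g 0 2],
    ![(x 0 ^ 2)⁻¹ * g 2 0 + 2 * (x 0)⁻¹ * x 1 * g 2 1, g 2 1, g 2 2]]

/-- The factors `ξ²`, `ξ⁴` in `cobV` are chosen so that in the frame of `U` six entries are exactly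
`g i j`. Only the other three carry negative powers of `z` and corrections, and these corrections
involve only the six. -/
theorem jac_comp_cobU (g : Fin 3 → Fin 3 → ℂ) {x : C3} (hx : x 0 ≠ 0) :
    (matCLM (jacMatrix x)).comp (matCLM (cobU g x)) =
      (matCLM (cobV g (tau x))).comp (matCLM (jacMatrix x)) := by
  ext v i
  simp only [ContinuousLinearMap.comp_apply]
  fin_cases i <;> simp [matCLM_apply_apply, jacMatrix, cobU, cobV] <;> field_simp <;> ring

theorem differentiable_cobV {g : Fin 3 → Fin 3 → C3 → ℂ} (hg : ∀ i j, Differentiable ℂ (g i j)) :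
    Differentiable ℂ fun y => matCLM (cobV (fun i j => g i j y) y) := by
  refine differentiable_matCLM fun i j => ?_
  have h := fun i j => hg i j
  fin_cases i <;> fin_cases j <;> simp [cobV] <;> fun_prop

/-- Every cocycle is, up to coboundaries, a combination of the generators with coefficients
that are entire functions of `u₂`. -/
theorem exists_normal_form (σ : sections (U ⊓ V)) :
    ∃ (h : Fin 6 → ℂ → ℂ) (A B : C3 → C3 →L[ℂ] C3), (∀ m, Differentiable ℂ (h m)) ∧
      Differentiable ℂ A ∧ Differentiable ℂ B ∧ ∀ x, x 0 ≠ 0 →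
        (matCLM (jacMatrix x)).comp
          (coc σ x - (∑ m, h m (x 2) • genCLM m 0 x) - A x) =
            (B (tau x)).comp (matCLM (jacMatrix x)) := by
  have hM := differentiableOn_entry σ
  choose P₀ G₀ hP₀ hG₀ h₀ using fun i j => exists_decomp_zero (hM i j)
  have hinv : DifferentiableOn ℂ (fun x : C3 => (x 0)⁻¹) {x | x 0 ≠ 0} :=
    DifferentiableOn.inv (by fun_prop) fun x hx => hx
  have hinv2 : DifferentiableOn ℂ (fun x : C3 => (x 0 ^ 2)⁻¹) {x | x 0 ≠ 0} :=
    DifferentiableOn.inv (by fun_prop) fun x hx => pow_ne_zero 2 hx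
  have hτ : ∀ i j, DifferentiableOn ℂ (fun x => G₀ i j (tau x)) {x | x 0 ≠ 0} := fun i j =>
    (hG₀ i j).comp_differentiableOn (contDiffOn_tau.differentiableOn (by simp))
  have k₁ : DifferentiableOn ℂ (fun x : C3 => 2 * (x 0)⁻¹ * x 1) {x | x 0 ≠ 0} :=
    (hinv.const_mul 2).fun_mul (by fun_prop)
  have k₂ : DifferentiableOn ℂ (fun x : C3 => 4 * (x 0 ^ 2)⁻¹ * x 1 ^ 2) {x | x 0 ≠ 0} :=
    (hinv2.const_mul 4).fun_mul (by fun_prop)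
  -- The three exceptional entries are decomposed only after removing what the `V`-parts of the
  -- other entries contribute to them in `cobU`.
  obtain ⟨P₁₀, G₁₀, h₁, hP₁₀, hG₁₀, hh₁, e₁₀⟩ := exists_decomp_four
    (f := fun x => entry (coc σ x) 1 0 - 2 * (x 0)⁻¹ * x 1 * (G₀ 1 1 (tau x) - G₀ 0 0 (tau x)) -
      4 * (x 0 ^ 2)⁻¹ * x 1 ^ 2 * G₀ 0 1 (tau x))
    (((hM 1 0).fun_sub (k₁.fun_mul ((hτ 1 1).fun_sub (hτ 0 0)))).fun_sub (k₂.fun_mul (hτ 0 1)))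
  obtain ⟨P₁₂, G₁₂, h₂, hP₁₂, hG₁₂, hh₂, e₁₂⟩ := exists_decomp_two
    (f := fun x => entry (coc σ x) 1 2 + 2 * (x 0)⁻¹ * x 1 * G₀ 0 2 (tau x))
    ((hM 1 2).fun_add (k₁.fun_mul (hτ 0 2)))
  obtain ⟨P₂₀, G₂₀, h₃, hP₂₀, hG₂₀, hh₃, e₂₀⟩ := exists_decomp_two
    (f := fun x => entry (coc σ x) 2 0 - 2 * (x 0)⁻¹ * x 1 * G₀ 2 1 (tau x))
    ((hM 2 0).fun_sub (k₁.fun_mul (hτ 2 1)))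
  let P : Fin 3 → Fin 3 → C3 → ℂ :=
    ![![P₀ 0 0, P₀ 0 1, P₀ 0 2], ![P₁₀, P₀ 1 1, P₁₂], ![P₂₀, P₀ 2 1, P₀ 2 2]]
  let G : Fin 3 → Fin 3 → C3 → ℂ :=
    ![![G₀ 0 0, G₀ 0 1, G₀ 0 2], ![G₁₀, G₀ 1 1, G₁₂], ![G₂₀, G₀ 2 1, G₀ 2 2]]
  have hP : ∀ i j, Differentiable ℂ (P i j) := by
    intro i j
    fin_cases i <;> fin_cases j <;> first | exact hP₀ _ _ | assumption
  have hG : ∀ i j, Differentiable ℂ (G i j) := by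
    intro i j
    fin_cases i <;> fin_cases j <;> first | exact hG₀ _ _ | assumption
  refine ⟨![h₁ 0, h₁ 1, h₁ 2, h₁ 3, h₂, h₃], fun x => matCLM fun i j => P i j x,
    fun y => matCLM (cobV (fun i j => G i j y) y), ?_, differentiable_matCLM hP,
    differentiable_cobV hG, fun x hx => ?_⟩
  · intro m
    fin_cases m
    exacts [hh₁ 0, hh₁ 1, hh₁ 2, hh₁ 3, hh₂, hh₃]
  · rw [← jac_comp_cobU _ hx]
    congr 1
    rw [sub_sub, sub_eq_iff_eq_add, ← matCLM_entry (coc σ x)]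
    ext v i
    have d := fun i j => h₀ i j x hx
    have e₁ := e₁₀ x hx
    have e₂ := e₁₂ x hx
    have e₃ := e₂₀ x hx
    rw [sub_sub, sub_eq_iff_eq_add] at e₁
    rw [← eq_sub_iff_add_eq] at e₂
    rw [sub_eq_iff_eq_add] at e₃
    simp only [add_apply, Fin.sum_univ_six, Pi.add_apply,
      smul_apply, Pi.smul_apply]
    simp only [matCLM_apply_apply, genCLM_apply]
    fin_cases i <;>
      simp [genMatrix, cobU, P, G, d 0 0, d 0 1, d 0 2, d 1 1, d 2 1, d 2 2, e₁, e₂, e₃] <;> ring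

/-! ### Convergent series and first-order deformations -/

theorem smul_gen (a : ℂ) (i : Fin 6 × ℕ) (p : (U ⊓ V : TopologicalSpace.Opens W2)) :
    a • gen i p =
      endOf p ((a * coordU p 2 ^ i.2) • genCLM i.1 0 (coordU p)) := by
  rw [gen_eq, genCLM_eq_smul, mul_smul]
  rfl

/-- The automorphism `1 + ε a`. -/
def infAutOf {O : TopologicalSpace.Opens W2} (a : sections O) : InfAut O where
  val p := TrivSqZeroExt.inl 1 + TrivSqZeroExt.inr (a.1 p)
  fst_eq p := by simp
  snd_hol := by
    have h : (fun p : O => (TrivSqZeroExt.inl 1 + TrivSqZeroExt.inr (a.1 p) :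
        DualNumber (EndT p)).snd) = a.1 := by
      funext p
      simp
    rw [h]
    exact a.2

theorem infAutOf_snd {O : TopologicalSpace.Opens W2} (a : sections O) (p : O) :
    ((infAutOf a).val p).snd = a.1 p := by simp [infAutOf]

/-- Every class is represented by a convergent series of multiples of the generators. -/
theorem exists_series (ξ : H1) : ∃ (c : Fin 6 × ℕ → ℂ) (s : sections (U ⊓ V)),
    (∀ p, HasSum (fun i => c i • gen i p) (s.1 p)) ∧ cls s = ξ := by
  obtain ⟨σ, rfl⟩ := Submodule.mkQ_surjective _ ξ
  obtain ⟨h, A, B, hh, hA, hB, hAB⟩ := exists_normal_form σ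
  have hd : DifferentiableOn ℂ (fun x : C3 => ∑ m, h m (x 2) • genCLM m 0 x)
      {x | x 0 ≠ 0} :=
    DifferentiableOn.fun_sum fun m _ =>
      (((hh m).comp (differentiable_apply (2 : Fin 3))).differentiableOn).fun_smul
        (differentiableOn_genMatrix m 0)
  refine ⟨fun i => (Nat.factorial i.2 : ℂ)⁻¹ * iteratedDeriv i.2 (h i.1) 0, ofCoc _ hd,
    fun p => ?_, ?_⟩
  · simp only [smul_gen]
    have hm : ∀ m, HasSum (fun k : ℕ => ((Nat.factorial k : ℂ)⁻¹ * iteratedDeriv k (h m) 0 *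
        (coordU p 2) ^ k) • genCLM m 0 (coordU p))
        (h m (coordU p 2) • genCLM m 0 (coordU p)) := by
      intro m
      refine HasSum.smul_const ?_ _
      refine (Complex.hasSum_taylorSeries_of_entire (hh m) 0 (coordU p 2)).congr_fun fun k => ?_
      simp only [sub_zero, smul_eq_mul]
      ring
    -- Each Taylor series is extended by zero to the index set `Fin 6 × ℕ`; the sum over `m` then
    -- has exactly one nonzero summand at each index.
    have hm' : ∀ m, HasSum (fun i : Fin 6 × ℕ => if i.1 = m then
        ((Nat.factorial i.2 : ℂ)⁻¹ * iteratedDeriv i.2 (h i.1) 0 *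
        (coordU p 2) ^ i.2) • genCLM i.1 0 (coordU p) else 0)
        (h m (coordU p 2) • genCLM m 0 (coordU p)) := by
      intro m
      rw [← (Prod.mk_right_injective m).hasSum_iff]
      · simpa [Function.comp_def] using hm m
      · rintro ⟨m', k⟩ hi
        exact if_neg fun h' => hi ⟨k, by simpa using h'.symm⟩
    have := hasSum_sum (s := Finset.univ) fun m _ => hm' m
    simp only [Finset.sum_ite_eq, Finset.mem_univ, if_true] at this
    exact this
  · refine (Submodule.Quotient.eq _).2 ?_
    rw [← neg_mem_iff, neg_sub]
    refine (mem_range_cechD_iff _).2 ⟨A, B, hA, hB, fun x hx => ?_⟩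
    rw [← hAB x hx, coc_sub _ _ hx, coc_ofCoc _ hx]

/-- The tangent space of the moduli is `H¹`. -/
theorem exists_moduli_equiv : ∃ Φ : ModuliTangentSpace ≃ H1,
    ∀ g : FirstOrderDeformation, Φ (Quot.mk _ g) = cls g.cocycle := by
  have hiso : ∀ g g' : FirstOrderDeformation,
      FirstOrderDeformation.Iso g g' ↔ cls g.cocycle = cls g'.cocycle := by
    intro g g'
    rw [eq_comm]
    change _ ↔ Submodule.Quotient.mk _ = Submodule.Quotient.mk _
    rw [Submodule.Quotient.eq]
    constructor
    · rintro ⟨a, b, hab⟩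
      refine ⟨(⟨fun p => (a.val p).snd, a.snd_hol⟩, ⟨fun p => (b.val p).snd, b.snd_hol⟩), ?_⟩
      refine Subtype.ext (funext fun p => ?_)
      have := congrArg TrivSqZeroExt.snd (hab p)
      simp only [TrivSqZeroExt.snd_mul, b.fst_eq, g.fst_eq, g'.fst_eq, a.fst_eq,
        MulOpposite.op_one, one_smul] at this
      change (b.val ⟨p.1, p.2.2⟩).snd - (a.val ⟨p.1, p.2.1⟩).snd =
        (g'.val p).snd - (g.val p).snd
      rw [sub_eq_sub_iff_add_eq_add, add_comm, add_comm (g'.val p).snd]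
      exact this
    · rintro ⟨⟨a, b⟩, hab⟩
      refine ⟨infAutOf a, infAutOf b, fun p => ?_⟩
      · have h : b.1 ⟨p.1, p.2.2⟩ - a.1 ⟨p.1, p.2.1⟩ = (g'.val p).snd - (g.val p).snd :=
          congrFun (congrArg Subtype.val hab) p
        refine TrivSqZeroExt.ext ?_ ?_
        · simp [g.fst_eq, g'.fst_eq, InfAut.fst_eq]
        · simp only [TrivSqZeroExt.snd_mul, infAutOf_snd, g.fst_eq, g'.fst_eq, InfAut.fst_eq,
            MulOpposite.op_one, one_smul]
          rw [sub_eq_sub_iff_add_eq_add] at h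
          rw [add_comm, h, add_comm]
  have hinj : Function.Injective (Quot.lift (fun g : FirstOrderDeformation => cls g.cocycle)
      fun g g' h => (hiso g g').1 h) := by
    rintro ⟨g⟩ ⟨g'⟩ h
    exact Quot.sound ((hiso g g').2 h)
  have hsurj : Function.Surjective (Quot.lift (fun g : FirstOrderDeformation => cls g.cocycle)
      fun g g' h => (hiso g g').1 h) := by
    intro ξ
    obtain ⟨σ, rfl⟩ := Submodule.mkQ_surjective _ ξ
    refine ⟨Quot.mk _ (infAutOf σ), ?_⟩
    change cls _ = cls σ
    congr 1
    exact Subtype.ext (funext fun p => infAutOf_snd σ p)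
  exact ⟨Equiv.ofBijective _ ⟨hinj, hsurj⟩, fun g => rfl⟩

/-! ### Independent classes -/

/-- A nontrivial combination of the cocycles `z⁻¹ u₂ᵏ E₂₃` is not a coboundary. -/
theorem eq_zero_of_mem_range {σ : sections (U ⊓ V)} {h : ℂ → ℂ}
    (hσ : ∀ x, x 0 ≠ 0 → coc σ x = h (x 2) • genCLM 4 0 x)
    (hmem : σ ∈ LinearMap.range cechD) (t : ℂ) : h t = 0 := by
  obtain ⟨A, B, hA, hB, hAB⟩ := (mem_range_cechD_iff σ).1 hmem
  let pt : ℂ → C3 := fun z => ![z, 0, t]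
  have hpt : Differentiable ℂ pt :=
    differentiable_vec (by fun_prop) (by fun_prop) (by fun_prop)
  have he : ∀ f : C3 → C3 →L[ℂ] C3, Differentiable ℂ f →
      Differentiable ℂ fun z => f (pt z) (Pi.single 2 1) 1 := fun f hf =>
    differentiable_pi.1 ((hf.comp hpt).clm_apply (differentiable_const _)) 1
  -- The factor `z²` is the middle diagonal entry of the Jacobian, which along `u₁ = 0` is alone in
  -- its row. The resulting function is entire in `z`, and for `z ≠ 0` it is an entire function of
  -- `z⁻¹`.
  have hF : Differentiable ℂ fun z => z * h t - z ^ 2 * A (pt z) (Pi.single 2 1) 1 :=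
    Differentiable.fun_sub (by fun_prop) (Differentiable.fun_mul (by fun_prop) (he A hA))
  have hFB : ∀ z : ℂ, z ≠ 0 → z * h t - z ^ 2 * A (pt z) (Pi.single 2 1) 1 =
      B (pt z⁻¹) (Pi.single 2 1) 1 := by
    intro z hz
    have h1 := congrFun (DFunLike.congr_fun (hAB (pt z) hz) (Pi.single 2 1)) 1
    have h2 : tau (pt z) = pt z⁻¹ := by
      funext i
      fin_cases i <;> simp [pt]
    have h3 : matCLM (jacMatrix (pt z)) (Pi.single 2 1) = Pi.single 2 1 := by
      funext i
      fin_cases i <;> simp [matCLM_apply_apply, jacMatrix]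
    have h4 : genCLM 4 0 (pt z) (Pi.single 2 1) 1 = z⁻¹ := by
      simp [genCLM_apply, genMatrix, pt]
    rw [ContinuousLinearMap.comp_apply, ContinuousLinearMap.comp_apply, h3, h2,
      matCLM_apply_apply, hσ _ hz] at h1
    rw [← h1]
    simp only [sub_apply, smul_apply, Pi.sub_apply, Pi.smul_apply, h4]
    simp [jacMatrix, pt]
    field_simp
  have hlim : Filter.Tendsto (fun z => z * h t - z ^ 2 * A (pt z) (Pi.single 2 1) 1)
      (Filter.cocompact ℂ) (𝓝 (B (pt 0) (Pi.single 2 1) 1)) := by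
    have h1 : Filter.Tendsto (fun ξ : ℂ => ξ⁻¹) (Filter.cocompact ℂ) (𝓝 0) := by
      rw [← Metric.cobounded_eq_cocompact]
      exact Filter.tendsto_inv₀_cobounded
    refine (((he B hB).continuous.tendsto 0).comp h1).congr' ?_
    have h3 : ∀ᶠ ξ : ℂ in Filter.cocompact ℂ, ξ ≠ 0 :=
      (isCompact_singleton (x := (0 : ℂ))).compl_mem_cocompact
    filter_upwards [h3] with z hz
    exact (hFB z hz).symm
  -- Liouville's theorem: the function is constant, and it vanishes at `z = 0`.
  have hconst := fun z => hF.apply_eq_of_tendsto_cocompact z hlim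
  have h0 : ∀ z, z * h t - z ^ 2 * A (pt z) (Pi.single 2 1) 1 = 0 := fun z => by
    rw [hconst z, ← hconst 0]
    simp
  have hz : ∀ z : ℂ, z ≠ 0 → h t - z * A (pt z) (Pi.single 2 1) 1 = 0 := fun z hz => by
    have := h0 z
    apply mul_left_cancel₀ hz
    linear_combination this
  have hc : Continuous fun z => h t - z * A (pt z) (Pi.single 2 1) 1 :=
    continuous_const.sub (continuous_id.mul (he A hA).continuous)
  -- Division by `z` was legitimate only for `z ≠ 0`; continuity extends the identity to `z = 0`,
  -- where it reads `h t = 0`.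
  have hz0 := (hc.ext_on (dense_compl_singleton (0 : ℂ)) continuous_const (fun z hz' => hz z hz'))
  simpa using congrFun hz0 0

/-! ### Families of every dimension -/

theorem isNilpotent_smul_single (a : ℂ) (x : C3) :
    IsNilpotent (a • genCLM 4 0 x) := by
  refine ⟨2, ?_⟩
  ext v i
  simp [pow_two, mul_apply_eq_comp, genCLM_apply, genMatrix, Matrix.single_apply]

/-- The polynomial with given coefficients, as a function. -/
def polyFun {n : ℕ} (v : Fin n → ℂ) (t : ℂ) : ℂ := ∑ k, v k * t ^ (k : ℕ)

theorem polyFun_add {n : ℕ} (v w : Fin n → ℂ) (t : ℂ) :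
    polyFun (v + w) t = polyFun v t + polyFun w t := by
  simp [polyFun, add_mul, Finset.sum_add_distrib]

theorem polyFun_smul {n : ℕ} (a : ℂ) (v : Fin n → ℂ) (t : ℂ) :
    polyFun (a • v) t = a * polyFun v t := by
  simp [polyFun, Finset.mul_sum, mul_assoc]

theorem polyFun_eq_zero {n : ℕ} {v : Fin n → ℂ} (h : ∀ t, polyFun v t = 0) : v = 0 := by
  have h1 : (∑ k : Fin n, Polynomial.C (v k) * Polynomial.X ^ (k : ℕ)) = 0 :=
    Polynomial.funext fun t => by
      simpa [Polynomial.eval_finsetSum, polyFun] using h t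
  funext j
  have h2 := congrArg (fun q => Polynomial.coeff q (j : ℕ)) h1
  simpa [Polynomial.finsetSum_coeff, Polynomial.coeff_C_mul, Polynomial.coeff_X_pow,
    Fin.val_inj] using h2

theorem differentiable_polyFun {n : ℕ} :
    Differentiable ℂ fun x : (Fin n → ℂ) × ℂ => polyFun x.1 x.2 := by
  unfold polyFun
  fun_prop

/-- The matrix function `z⁻¹ p(u₂) E₂₃`, where `p` is the polynomial with coefficients `t`. -/
def famMatrix {n : ℕ} (t : Fin n → ℂ) (x : C3) : C3 →L[ℂ] C3 :=
  polyFun t (x 2) • genCLM 4 0 x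

theorem famMatrix_add {n : ℕ} (v w : Fin n → ℂ) (x : C3) :
    famMatrix (v + w) x = famMatrix v x + famMatrix w x := by
  ext u i
  simp [famMatrix, polyFun_add, add_mul]

theorem famMatrix_smul {n : ℕ} (a : ℂ) (v : Fin n → ℂ) (x : C3) :
    famMatrix (a • v) x = a • famMatrix v x := by
  ext u i
  simp [famMatrix, polyFun_smul, mul_assoc]

theorem differentiableOn_famMatrix {n : ℕ} :
    DifferentiableOn ℂ (fun x : (Fin n → ℂ) × C3 => famMatrix x.1 x.2) {x | x.2 0 ≠ 0} := by
  refine DifferentiableOn.fun_smul ?_ ?_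
  · exact (differentiable_polyFun.comp (f := fun x : (Fin n → ℂ) × C3 => (x.1, x.2 2))
      (by fun_prop)).differentiableOn
  · exact (differentiableOn_genMatrix 4 0).comp (f := Prod.snd) (by fun_prop) fun x hx => hx

theorem differentiableOn_famMatrix_right {n : ℕ} (v : Fin n → ℂ) :
    DifferentiableOn ℂ (famMatrix v) {x | x 0 ≠ 0} :=
  differentiableOn_famMatrix.comp (f := fun x => (v, x)) (by fun_prop) fun x hx => hx

/-- The Kodaira–Spencer map of the family `1 + z⁻¹ p(u₂) E₂₃`. -/
def famKS (n : ℕ) : (Fin n → ℂ) →ₗ[ℂ] sections (U ⊓ V) where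
  toFun v := ofCoc (famMatrix v) (differentiableOn_famMatrix_right v)
  map_add' v w := Subtype.ext (funext fun p => by
    change endOf p (famMatrix (v + w) _) = endOf p (famMatrix v _ + famMatrix w _)
    rw [famMatrix_add])
  map_smul' a v := Subtype.ext (funext fun p => by
    change endOf p (famMatrix (a • v) _) = endOf p (a • famMatrix v _)
    rw [famMatrix_smul])

theorem mdifferentiableOn_prodMap_coordU {E : Type*} [NormedAddCommGroup E] [NormedSpace ℂ E] :
    MDifferentiableOn (𝓘(ℂ, E).prod 𝓘(ℂ, C3)) 𝓘(ℂ, E × C3)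
      (fun y : E × W2 => (y.1, coordU y.2))
      (Set.univ ×ˢ ((U ⊓ V : TopologicalSpace.Opens W2) : Set W2)) := fun x hx =>
  mdifferentiableWithinAt_fst.prodMk_space
    ((mdifferentiableOn_coordU x.2 hx.2.1).comp x mdifferentiableWithinAt_snd fun _ hy => hy.2.1)

/-- Families of sections over `U ∩ V` that are holomorphic in the frame of `U` are holomorphic. -/
theorem mdifferentiableOn_family {E : Type*} [NormedAddCommGroup E] [NormedSpace ℂ E]
    {f : E × C3 → C3 →L[ℂ] C3} (hf : DifferentiableOn ℂ f {x | x.2 0 ≠ 0}) :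
    MDifferentiableOn (𝓘(ℂ, E).prod 𝓘(ℂ, C3)) (𝓘(ℂ, C3).prod 𝓘(ℂ, C3 →L[ℂ] C3))
      (fun x : E × W2 => TotalSpace.mk' (C3 →L[ℂ] C3) (E := EndT) x.2
        (extend (fun p : (U ⊓ V : TopologicalSpace.Opens W2) =>
          endOf p (f (x.1, coordU p))) x.2))
      (Set.univ ×ˢ ((U ⊓ V : TopologicalSpace.Opens W2) : Set W2)) := by
  intro x hx
  have hU : x.2 ∈ U := hx.2.1
  have hs : x.2 ∈ (chartAt C3 (ptU 0)).source := by rw [chartAt_source_U]; exact hU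
  refine (Trivialization.mdifferentiableWithinAt_totalSpace_iff 𝓘(ℂ, C3)
    (trivializationAt (C3 →L[ℂ] C3) EndT (ptU 0)) _
    (show x.2 ∈ (chartAt C3 (ptU 0)).source ∩ (chartAt C3 (ptU 0)).source from ⟨hs, hs⟩)).2
    ⟨mdifferentiableWithinAt_snd, ?_⟩
  have hx0 : coordU x.2 0 ≠ 0 := ptU_mem_inf.1 (by rw [ptU_coordU hU]; exact hx.2)
  have h1 := (hf.differentiableAt (x := (x.1, coordU x.2))
    ((isOpen_ne.preimage continuous_snd).mem_nhds hx0)).mdifferentiableAt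
  have h3 := MDifferentiableAt.comp_mdifferentiableWithinAt (g := f) x h1
    (mdifferentiableOn_prodMap_coordU x hx)
  have key : ∀ y ∈ (Set.univ : Set E) ×ˢ ((U ⊓ V : TopologicalSpace.Opens W2) : Set W2),
      endCoord (ptU 0) y.2 (extend (fun p : (U ⊓ V : TopologicalSpace.Opens W2) =>
        endOf p (f (y.1, coordU p))) y.2) = f (y.1, coordU y.2) := by
    rintro ⟨t, p⟩ ⟨-, hp⟩
    rw [endCoord_U hp.1, extend_of_mem _ hp]
    rfl
  exact h3.congr key (key x hx)

/-- The family of bundles glued by `1 + z⁻¹ p(u₂) E₂₃`. -/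
def fam (n : ℕ) : Family n where
  θ t p := endOf p (1 + famMatrix t (coordU p))
  hol := mdifferentiableOn_family (f := fun x => 1 + famMatrix x.1 x.2)
    ((differentiableOn_const _).fun_add differentiableOn_famMatrix)
  isUnit t p := (isNilpotent_smul_single _ _).isUnit_one_add
  zero p := by
    have h : famMatrix (0 : Fin n → ℂ) (coordU p) = 0 := by
      ext u i
      simp [famMatrix, polyFun]
    rw [h, add_zero]
    rfl

theorem fam_isKodairaSpencer (n : ℕ) : (fam n).IsKodairaSpencer (famKS n) := by
  intro v p
  have h : ∀ s : ℂ, 1 + famMatrix (s • v) (coordU p) = 1 + s • famMatrix v (coordU p) := fun s => by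
    rw [famMatrix_smul]
  have h1 : HasDerivAt (fun s : ℂ => 1 + s • famMatrix v (coordU p)) (famMatrix v (coordU p)) 0 := by
    simpa using ((hasDerivAt_id (0 : ℂ)).smul_const (famMatrix v (coordU p))).const_add 1
  simp only [← h] at h1
  exact h1

/-- A vector in the kernel gives a coboundary `z⁻¹ p(u₂) E₂₃`, so the polynomial `p` vanishes at
every point. -/
theorem cls_famKS_injective (n : ℕ) : Function.Injective fun v => cls (famKS n v) := by
  have h : Function.Injective (cls.comp (famKS n)) := by
    rw [← LinearMap.ker_eq_bot, LinearMap.ker_eq_bot']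
    intro v hv
    refine polyFun_eq_zero (eq_zero_of_mem_range (σ := famKS n v) (fun x hx => ?_)
      ((Submodule.Quotient.mk_eq_zero _).1 hv))
    exact coc_ofCoc (differentiableOn_famMatrix_right v) hx
  exact h

theorem not_finiteDimensional_H1 : ¬ FiniteDimensional ℂ H1 := by
  intro _
  -- A family with one parameter more than the supposed dimension gives a contradiction.
  have h := LinearMap.finrank_le_finrank_of_injective
    (f := cls.comp (famKS (Module.finrank ℂ H1 + 1))) (cls_famKS_injective _)
  simp at h

end LocalCY

end

open LocalCY in
/-- `W₂` has infinite-dimensional moduli of holomorphic bundles. -/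
theorem mainTheorem5 :
    -- the Zariski tangent space of the moduli at `TW₂` is `H¹(W₂, End(TW₂))`,
    (∃ Φ : ModuliTangentSpace ≃ H1,
      ∀ g : FirstOrderDeformation, Φ (Quot.mk _ g) = cls g.cocycle) ∧
    -- which is infinite-dimensional;
    (¬ FiniteDimensional ℂ H1) ∧
    -- `TW₂` lies in effectively parametrised families of bundles of every dimension;
    (∀ n : ℕ, ∃ (𝓔 : Family n) (κ : (Fin n → ℂ) →ₗ[ℂ] sections (U ⊓ V)),
      𝓔.IsKodairaSpencer κ ∧ Function.Injective fun v => cls (κ v)) ∧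
    -- the listed cocycles are holomorphic, and every class is represented by a convergent series
    -- of multiples of them.
    (∀ i, gen i ∈ sections (U ⊓ V)) ∧
    (∀ x : H1, ∃ (c : Fin 6 × ℕ → ℂ) (s : sections (U ⊓ V)),
      (∀ p, HasSum (fun i => c i • gen i p) (s.1 p)) ∧ cls s = x) := by
  exact ⟨exists_moduli_equiv, not_finiteDimensional_H1,
    fun n => ⟨fam n, famKS n, fam_isKodairaSpencer n, cls_famKS_injective n⟩, gen_mem,
    exists_series⟩
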